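/- Let $0<\Theta<2\pi$ and $Q=(0,1)\times(0,\Theta)$, with points written $(r,\theta)$. For a positive weight $w$ let $L^2_w(Q)$ be the space of measurable $v:Q\to\mathbb R$ with $\|v\|_{L^2_w(Q)}^2=\int_Q v^2\,w\,\mathrm dr\,\mathrm d\theta<\infty$; we use $w=r$ and $w=1/r$. All derivatives are weak derivatives. Let $\tilde H^1(Q)$ be the space of $v\in L^2_r(Q)$ with $\partial_r v\in L^2_r(Q)$ and $\partial_\theta v\in L^2_{1/r}(Q)$, normed by $$\|v\|_{\tilde H^1(Q)}^2=\|v\|_{L^2_r(Q)}^2+\|\partial_r v\|_{L^2_r(Q)}^2+\|\partial_\theta v\|_{L^2_{1/r}(Q)}^2 .$$ Let $U\subset\tilde H^1(Q)$ be the closure of $C^\infty(\overline Q)\cap\tilde H^1(Q)$ with respect to the norm $\|v\|_U=(\|v\|_{\tilde H^1(Q)}^2+\|\partial_{r\theta}v\|_{L^2_r(Q)}^2)^{1/2}$, and let $U'$ be the set of $u\in U$ with $\partial_{\theta\theta}u\in L^2_{1/r}(Q)$. Let $H^1_r(0,1)$ be the space of $g$ on $(0,1)$ with $\|g\|_{H^1_r(0,1)}^2=\int_0^1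 r\,(g^2+(g')^2)\,\mathrm dr<\infty$. For $0\le\vartheta\le\Theta$ let the radial trace $\gamma_\vartheta:U\to H^1_r(0,1)$ be the extension by continuity of the restriction map $\varphi\mapsto\varphi(\cdot,\vartheta)$ from $C^\infty(\overline Q)\cap\tilde H^1(Q)$ with the $U$-norm. For a partition $0=\theta_1<\theta_2<\dots<\theta_N=\Theta$ with mesh size $h=\max_i(\theta_{i+1}-\theta_i)$, let $e_1,\dots,e_N$ be the continuous piecewise linear functions on $[0,\Theta]$, linear on each $[\theta_i,\theta_{i+1}]$, with $e_i(\theta_j)=\delta_{ij}$, and for $u\in U$ let $$(\Pi u)(r,\theta)=\sum_{i=1}^N(\gamma_{\theta_i}u)(r)\,e_i(\theta).$$ **Theorem.** There is a constant $C>0$, independent of $u$ and of the partition, such that for every $u\in U'$ and every such partition the traces $\gamma_{\theta_i}u$ exist, $\Pi u\in\tilde H^1(Q)$, $$\|u-\Pi u\|_{L^2_r(Q)}\le h^2\,\|\partial_{\theta\theta}u\|_{L^2_{1/r}(Q)}$$ and $$\|u-\Pi u\|_{\tilde H^1(Q)}\le C\,h\left(\|\partial_{r\theta}u\|_{L^2_r(Q)}^2+\|\partial_{\theta\theta}u\|_{L^2_{1/r}(Q)}^2\right)^{1/2}.$$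 More precisely, $$\|u-\Pi u\|_{\tilde H^1(Q)}^2\le h^2(h^2+4)\left(\|\partial_{r\theta}u\|_{L^2_r(Q)}^2+\|\partial_{\theta\theta}u\|_{L^2_{1/r}(Q)}^2\right).$$ -/

import Mathlib

open MeasureTheory Set Filter Topology
open scoped ContDiff

namespace SBFEM

noncomputable section

/-! ### Weighted Lebesgue spaces and weak derivatives on an open set `Ω`
(used with `Ω = Q ⊆ ℝ × ℝ` and with `Ω = (0,1) ⊆ ℝ`). Functions are everywhere-defined
representatives; only their values almost everywhere on `Ω` matter. -/

section General

variable {E : Type*} [NormedAddCommGroup E] [NormedSpace ℝ E] [MeasureSpace E]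

/-- `v ∈ L²_w(Ω)`: `v` is (a.e.) measurable on `Ω` and `∫_Ω v² w < ∞`. -/
def MemL2 (Ω : Set E) (w : E → ℝ) (v : E → ℝ) : Prop :=
  AEStronglyMeasurable v (volume.restrict Ω) ∧ IntegrableOn (fun x => v x ^ 2 * w x) Ω

/-- The norm of `L²_w(Ω)`. -/
def normL2 (Ω : Set E) (w : E → ℝ) (v : E → ℝ) : ℝ :=
  Real.sqrt (∫ x in Ω, v x ^ 2 * w x)

/-- `g` is a weak derivative of `u` on `Ω` in the direction `e`. -/
def IsWeakDeriv (Ω : Set E) (e : E) (u g : E → ℝ) : Prop :=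
  LocallyIntegrableOn u Ω ∧ LocallyIntegrableOn g Ω ∧
    ∀ φ : E → ℝ, ContDiff ℝ ∞ φ → HasCompactSupport φ → tsupport φ ⊆ Ω →
      ∫ x in Ω, u x * fderiv ℝ φ x e = - ∫ x in Ω, g x * φ x

/-- `u` has a weak derivative on `Ω` in the direction `e`. -/
def WeaklyDifferentiable (Ω : Set E) (e : E) (u : E → ℝ) : Prop :=
  ∃ g, IsWeakDeriv Ω e u g

open Classical in
/-- The weak derivative of `u` on `Ω` in the direction `e` (it is unique almost everywhere on
an open `Ω`); the value is `0` if `u` has none. -/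
def weakDeriv (Ω : Set E) (e : E) (u : E → ℝ) : E → ℝ :=
  if h : WeaklyDifferentiable Ω e u then h.choose else 0

end General

/-! ### The rectangle `Q = (0,1) × (0,Θ)`, with points `(r, θ)`, and the function spaces on it -/

/-- The open rectangle `Q = (0,1) × (0,Θ)`. -/
def Q (Θ : ℝ) : Set (ℝ × ℝ) := Ioo 0 1 ×ˢ Ioo 0 Θ

/-- The weight `r` on `Q`. -/
def wr (p : ℝ × ℝ) : ℝ := p.1

/-- The weight `1/r` on `Q`. -/
def wrInv (p : ℝ × ℝ) : ℝ := 1 / p.1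

/-- The direction of `∂_r`. -/
def dirR : ℝ × ℝ := (1, 0)

/-- The direction of `∂_θ`. -/
def dirTheta : ℝ × ℝ := (0, 1)

/-- The weak derivative `∂_r u` on `Q`. -/
def dR (Θ : ℝ) (u : ℝ × ℝ → ℝ) : ℝ × ℝ → ℝ := weakDeriv (Q Θ) dirR u

/-- The weak derivative `∂_θ u` on `Q`. -/
def dTheta (Θ : ℝ) (u : ℝ × ℝ → ℝ) : ℝ × ℝ → ℝ := weakDeriv (Q Θ) dirTheta u

/-- The mixed weak derivative `∂_{rθ} u` on `Q`. -/
def dRTheta (Θ : ℝ) (u : ℝ × ℝ → ℝ) : ℝ × ℝ → ℝ := dTheta Θ (dR Θ u)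

/-- The second angular weak derivative `∂_{θθ} u` on `Q`. -/
def dThetaTheta (Θ : ℝ) (u : ℝ × ℝ → ℝ) : ℝ × ℝ → ℝ := dTheta Θ (dTheta Θ u)

/-- The weighted Sobolev space `H̃¹(Q)`: `v ∈ L²_r`, `∂_r v ∈ L²_r`, `∂_θ v ∈ L²_{1/r}`. -/
def MemH1 (Θ : ℝ) (v : ℝ × ℝ → ℝ) : Prop :=
  MemL2 (Q Θ) wr v ∧
  (WeaklyDifferentiable (Q Θ) dirR v ∧ MemL2 (Q Θ) wr (dR Θ v)) ∧
  (WeaklyDifferentiable (Q Θ) dirTheta v ∧ MemL2 (Q Θ) wrInv (dTheta Θ v))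

/-- The norm of `H̃¹(Q)`. -/
def normH1 (Θ : ℝ) (v : ℝ × ℝ → ℝ) : ℝ :=
  Real.sqrt (normL2 (Q Θ) wr v ^ 2 + normL2 (Q Θ) wr (dR Θ v) ^ 2
    + normL2 (Q Θ) wrInv (dTheta Θ v) ^ 2)

/-- The `U`-norm `(‖v‖²_{H̃¹(Q)} + ‖∂_{rθ} v‖²_{L²_r(Q)})^{1/2}`. -/
def normU (Θ : ℝ) (v : ℝ × ℝ → ℝ) : ℝ :=
  Real.sqrt (normH1 Θ v ^ 2 + normL2 (Q Θ) wr (dRTheta Θ v) ^ 2)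

/-- `C^∞(Q̄) ∩ H̃¹(Q)`, where `C^∞(Q̄)` consists of the restrictions to `Q̄` of smooth functions
on the plane. -/
def SmoothH1 (Θ : ℝ) (φ : ℝ × ℝ → ℝ) : Prop := ContDiff ℝ ∞ φ ∧ MemH1 Θ φ

/-- The space `U`: the closure of `C^∞(Q̄) ∩ H̃¹(Q)` in the `U`-norm. -/
def MemU (Θ : ℝ) (u : ℝ × ℝ → ℝ) : Prop :=
  MemH1 Θ u ∧
  (WeaklyDifferentiable (Q Θ) dirTheta (dR Θ u) ∧ MemL2 (Q Θ) wr (dRTheta Θ u)) ∧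
  ∃ φ : ℕ → ℝ × ℝ → ℝ, (∀ k, SmoothH1 Θ (φ k)) ∧
    Tendsto (fun k => normU Θ (φ k - u)) atTop (𝓝 0)

/-- The space `U'` of those `u ∈ U` with `∂_{θθ} u ∈ L²_{1/r}(Q)`. -/
def MemU' (Θ : ℝ) (u : ℝ × ℝ → ℝ) : Prop :=
  MemU Θ u ∧
  (WeaklyDifferentiable (Q Θ) dirTheta (dTheta Θ u) ∧ MemL2 (Q Θ) wrInv (dThetaTheta Θ u))

/-! ### The space `H¹_r(0,1)` and the radial trace operator -/

/-- The space `H¹_r(0,1)`: `g` and its weak derivative belong to `L²_r(0,1)`. -/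
def MemH1r (g : ℝ → ℝ) : Prop :=
  MemL2 (Ioo 0 1) (fun r => r) g ∧
  (WeaklyDifferentiable (Ioo 0 1) (1 : ℝ) g ∧
    MemL2 (Ioo 0 1) (fun r => r) (weakDeriv (Ioo 0 1) (1 : ℝ) g))

/-- The norm of `H¹_r(0,1)`. -/
def normH1r (g : ℝ → ℝ) : ℝ :=
  Real.sqrt (normL2 (Ioo 0 1) (fun r => r) g ^ 2
    + normL2 (Ioo 0 1) (fun r => r) (weakDeriv (Ioo 0 1) (1 : ℝ) g) ^ 2)

/-- `g` is the value at `u ∈ U` of the extension by continuity (from `C^∞(Q̄) ∩ H̃¹(Q)` with the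
`U`-norm, into `H¹_r(0,1)`) of the restriction operator `φ ↦ φ(·, ϑ)`. -/
def IsRadialTrace (Θ ϑ : ℝ) (u : ℝ × ℝ → ℝ) (g : ℝ → ℝ) : Prop :=
  MemU Θ u ∧ MemH1r g ∧
  ∃ φ : ℕ → ℝ × ℝ → ℝ, (∀ k, SmoothH1 Θ (φ k)) ∧
    Tendsto (fun k => normU Θ (φ k - u)) atTop (𝓝 0) ∧
    Tendsto (fun k => normH1r (fun r => φ k (r, ϑ) - g r)) atTop (𝓝 0)

open Classical in
/-- The radial trace `γ_ϑ u`; the value is `0` if there is none. -/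
def radialTrace (Θ ϑ : ℝ) (u : ℝ × ℝ → ℝ) : ℝ → ℝ :=
  if h : ∃ g, IsRadialTrace Θ ϑ u g then h.choose else 0

/-! ### Partitions, piecewise linear basis functions and the interpolant -/

/-- A partition `0 = θ₀ < θ₁ < ⋯ < θₙ = Θ`; only `node 0, …, node n` are used. -/
structure AngularPartition (Θ : ℝ) where
  n : ℕ
  node : ℕ → ℝ
  node_zero : node 0 = 0
  node_last : node n = Θ
  node_lt : ∀ i, i < n → node i < node (i + 1)

/-- The mesh size `h = max_i (θ_{i+1} - θ_i)`. -/
def AngularPartition.meshSize {Θ : ℝ} (T : AngularPartition Θ) : ℝ :=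
  ⨆ i : Fin T.n, (T.node ((i : ℕ) + 1) - T.node (i : ℕ))

/-- The continuous piecewise linear basis function `e_i` on `[0,Θ]`, with `e_i(θ_j) = δ_{ij}`. -/
def AngularPartition.hat {Θ : ℝ} (T : AngularPartition Θ) (i : ℕ) (θ : ℝ) : ℝ :=
  max 0 (min
    (if i = 0 then 1 else (θ - T.node (i - 1)) / (T.node i - T.node (i - 1)))
    (if i = T.n then 1 else (T.node (i + 1) - θ) / (T.node (i + 1) - T.node i)))

/-- The interpolant `(Π u)(r,θ) = ∑_i (γ_{θ_i} u)(r) e_i(θ)`. -/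
def interpolant {Θ : ℝ} (T : AngularPartition Θ) (u : ℝ × ℝ → ℝ) : ℝ × ℝ → ℝ :=
  fun p => ∑ i ∈ Finset.range (T.n + 1), radialTrace Θ (T.node i) u p.1 * T.hat i p.2

end

end SBFEM

/-! The weights depend on `r` only, so the estimate reduces to one-dimensional piecewise linear
interpolation in the angle on almost every slice `r = const`, integrated over `r`.

The reduction rests on a structure result: a function in `L²_r` with weak angular derivative `g` in
`L²_r` equals `c(r) + ∫_0^θ g(r,t) dt` almost everywhere (`IsWeakDeriv.exists_eq_primitive`). For `u
∈ U` this applies to `u` with `b = ∂_θ u`, and to `∂_r u` with `d = ∂_{rθ} u`; the two expansions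
form `AngularExpansion`. The trace at `ϑ` is then explicitly `k(r) + ∫_0^ϑ b`, and approximation by
smooth functions shows that its weak derivative is `k'(r) + ∫_0^ϑ d`. Consequently `∂_r` commutes
with interpolation.

On a slice, the slope of the interpolant on an element is the mean of `b` there. With `P` the
projection onto element means, the error is therefore `∫_0^θ (b - P b)` (`sub_sum_mul_hat_eq`), and
it vanishes at every node. Two elementary facts conclude. A primitive vanishing at the left end of
each element has `L²` norm at most `h` times that of its integrand (`setIntegral_primitive_sq_le`).
The mean is the best constant in `L²` (`setIntegral_sub_mean_sq_le`), so `‖b - P b‖ ≤ h ‖∂_θ b‖` and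
`‖d - P d‖ ≤ ‖d‖`. Hence the angular derivative of the error is `O(h)`, the error itself is `O(h²)`,
and its radial derivative `∫_0^θ (d - P d)` is `O(h)`. Since `r < 1`, the `L²_{1/r}` norm dominates
the `L²_r` norm, which reconciles the weights. -/

open MeasureTheory Set Filter Topology
open scoped ContDiff

set_option linter.unusedSectionVars false

namespace SBFEM

section General

variable {E : Type*} [NormedAddCommGroup E] [NormedSpace ℝ E] [MeasureSpace E]
  {Ω : Set E} {w : E → ℝ} {e : E} {u v g h ψ : E → ℝ}

/-! ### Weighted square-integrable functions -/

theorem MemL2.congr (hu : MemL2 Ω w u) (h : u =ᵐ[volume.restrict Ω] v) : MemL2 Ω w v :=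
  ⟨hu.1.congr h, hu.2.congr (h.mono fun x hx => by simp only [hx])⟩

theorem normL2_congr (h : u =ᵐ[volume.restrict Ω] v) : normL2 Ω w u = normL2 Ω w v := by
  unfold normL2
  congr 1
  exact integral_congr_ae (h.mono fun x hx => by simp only [hx])

theorem normL2_sq (hΩ : MeasurableSet Ω) (hw : ∀ x ∈ Ω, 0 ≤ w x) :
    normL2 Ω w u ^ 2 = ∫ x in Ω, u x ^ 2 * w x :=
  Real.sq_sqrt (setIntegral_nonneg hΩ fun x hx => mul_nonneg (sq_nonneg _) (hw x hx))

theorem MemL2.of_le (hΩ : MeasurableSet Ω) (hv : AEStronglyMeasurable v (volume.restrict Ω))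
    (hwm : AEStronglyMeasurable w (volume.restrict Ω)) (hw : ∀ x ∈ Ω, 0 ≤ w x)
    {F : E → ℝ} (hF : IntegrableOn F Ω) (hle : ∀ᵐ x ∂volume.restrict Ω, v x ^ 2 * w x ≤ F x) :
    MemL2 Ω w v := by
  refine ⟨hv, hF.mono' ((hv.pow 2).mul hwm) ?_⟩
  filter_upwards [hle, ae_restrict_mem hΩ] with x hx hxΩ
  rwa [Real.norm_of_nonneg (mul_nonneg (sq_nonneg _) (hw x hxΩ))]

theorem MemL2.add (hΩ : MeasurableSet Ω) (hwm : AEStronglyMeasurable w (volume.restrict Ω))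
    (hw : ∀ x ∈ Ω, 0 ≤ w x) (hu : MemL2 Ω w u) (hv : MemL2 Ω w v) : MemL2 Ω w (u + v) := by
  refine MemL2.of_le hΩ (hu.1.add hv.1) hwm hw ((hu.2.add hv.2).const_mul 2) ?_
  filter_upwards [ae_restrict_mem hΩ] with x hx
  simp only [Pi.add_apply]
  nlinarith [mul_nonneg (sq_nonneg (u x - v x)) (hw x hx)]

theorem MemL2.neg (hu : MemL2 Ω w u) : MemL2 Ω w (-u) :=
  ⟨hu.1.neg, hu.2.congr (ae_of_all _ fun x => by simp)⟩

theorem MemL2.sub (hΩ : MeasurableSet Ω) (hwm : AEStronglyMeasurable w (volume.restrict Ω))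
    (hw : ∀ x ∈ Ω, 0 ≤ w x) (hu : MemL2 Ω w u) (hv : MemL2 Ω w v) : MemL2 Ω w (u - v) := by
  rw [sub_eq_add_neg]
  exact hu.add hΩ hwm hw hv.neg

theorem MemL2.mono_weight {w' : E → ℝ} (hΩ : MeasurableSet Ω)
    (hwm : AEStronglyMeasurable w (volume.restrict Ω)) (hw : ∀ x ∈ Ω, 0 ≤ w x)
    (hle : ∀ x ∈ Ω, w x ≤ w' x) (hu : MemL2 Ω w' u) : MemL2 Ω w u := by
  refine MemL2.of_le hΩ hu.1 hwm hw hu.2 ?_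
  filter_upwards [ae_restrict_mem hΩ] with x hx
  exact mul_le_mul_of_nonneg_left (hle x hx) (sq_nonneg _)

/-- The Cauchy–Schwarz inequality for real integrals. -/
theorem sq_integral_mul_le {α : Type*} [MeasurableSpace α] {μ : Measure α} {f g : α → ℝ}
    (hf : AEStronglyMeasurable f μ) (hg : AEStronglyMeasurable g μ)
    (hf2 : Integrable (fun x => f x ^ 2) μ) (hg2 : Integrable (fun x => g x ^ 2) μ) :
    (∫ x, f x * g x ∂μ) ^ 2 ≤ (∫ x, f x ^ 2 ∂μ) * ∫ x, g x ^ 2 ∂μ := by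
  have hfg : Integrable (fun x => f x * g x) μ := by
    refine (hf2.add hg2).mono' (hf.mul hg) (ae_of_all _ fun x => ?_)
    rw [Real.norm_eq_abs, Pi.add_apply, abs_le]
    constructor <;> nlinarith [sq_nonneg (f x + g x), sq_nonneg (f x - g x), sq_nonneg (f x),
      sq_nonneg (g x)]
  -- The quadratic polynomial `t ↦ ∫ (f + t g)²` is nonnegative, so its discriminant is at most
  -- zero.
  have key : ∀ t : ℝ, 0 ≤ (∫ x, g x ^ 2 ∂μ) * (t * t) + (2 * ∫ x, f x * g x ∂μ) * t
      + ∫ x, f x ^ 2 ∂μ := by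
    intro t
    have h0 : 0 ≤ ∫ x, (f x + t * g x) ^ 2 ∂μ := integral_nonneg fun x => sq_nonneg _
    have h1 : ∫ x, (f x + t * g x) ^ 2 ∂μ
        = ∫ x, (g x ^ 2 * (t * t) + (2 * t) * (f x * g x) + f x ^ 2) ∂μ :=
      integral_congr_ae (ae_of_all _ fun x => by ring)
    have h2 : Integrable (fun x => g x ^ 2 * (t * t) + (2 * t) * (f x * g x)) μ :=
      (hg2.mul_const _).add (hfg.const_mul _)
    rw [h1, integral_add h2 hf2, integral_add (hg2.mul_const _) (hfg.const_mul _),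
      integral_mul_const, integral_const_mul] at h0
    linarith
  have := discrim_le_zero key
  unfold discrim at this
  nlinarith

section Topological

variable [BorelSpace E]

theorem integrable_mul_of_tsupport_subset (hu : LocallyIntegrableOn u Ω)
    (hψ : Continuous ψ) (hc : HasCompactSupport ψ) (hs : tsupport ψ ⊆ Ω) :
    Integrable (fun x => u x * ψ x) := by
  have h1 : IntegrableOn u (tsupport ψ) := hu.integrableOn_compact_subset hs hc
  have h2 : IntegrableOn (fun x => u x * ψ x) (tsupport ψ) :=
    h1.mul_continuousOn hψ.continuousOn hc
  refine (integrableOn_iff_integrable_of_support_subset fun x hx => ?_).1 h2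
  exact subset_tsupport _ (right_ne_zero_of_mul hx)

/-- On a nonempty compact subset of `Ω` the weight attains a positive minimum `m`, and `|u| ≤ 1 + u²
≤ 1 + m⁻¹ u² w`. -/
theorem MemL2.locallyIntegrableOn [ProperSpace E] [IsLocallyFiniteMeasure (volume : Measure E)]
    (hΩ : IsOpen Ω) (hwc : ContinuousOn w Ω)
    (hw : ∀ x ∈ Ω, 0 < w x) (hu : MemL2 Ω w u) : LocallyIntegrableOn u Ω := by
  rw [locallyIntegrableOn_iff hΩ.isLocallyClosed]
  intro K hK hKc
  have hKm : MeasurableSet K := hKc.measurableSet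
  rcases K.eq_empty_or_nonempty with rfl | hne
  · simp
  obtain ⟨x0, hx0, hmin⟩ := hKc.exists_isMinOn hne (hwc.mono hK)
  have hm : 0 < w x0 := hw _ (hK hx0)
  have h1 : IntegrableOn (fun x => 1 + (w x0)⁻¹ * (u x ^ 2 * w x)) K :=
    (integrableOn_const hKc.measure_lt_top.ne).add ((hu.2.mono_set hK).const_mul _)
  refine h1.mono' (hu.1.mono_set hK) ?_
  filter_upwards [ae_restrict_mem hKm] with x hx
  have h2 : w x0 ≤ w x := hmin hx
  have h3 : u x ^ 2 ≤ (w x0)⁻¹ * (u x ^ 2 * w x) := by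
    rw [inv_mul_eq_div, le_div_iff₀ hm]
    exact mul_le_mul_of_nonneg_left h2 (sq_nonneg _)
  rw [Real.norm_eq_abs]
  nlinarith [sq_nonneg (|u x| - 1), sq_abs (u x)]

/-! ### Weak derivatives -/

theorem continuous_fderiv_apply_const {φ : E → ℝ} (hφ : ContDiff ℝ ∞ φ) (e : E) :
    Continuous fun x => fderiv ℝ φ x e :=
  (hφ.continuous_fderiv (by simp)).clm_apply continuous_const

theorem IsWeakDeriv.congr (hu : IsWeakDeriv Ω e u g) (huv : u =ᵐ[volume.restrict Ω] v)
    (hgh : g =ᵐ[volume.restrict Ω] h) : IsWeakDeriv Ω e v h := by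
  refine ⟨?_, ?_, fun φ hφ hc hs => ?_⟩
  · intro x hx
    obtain ⟨s, hs, hi⟩ := hu.1 x hx
    refine ⟨s ∩ Ω, inter_mem hs self_mem_nhdsWithin, ?_⟩
    exact (hi.mono_set inter_subset_left).congr_fun_ae (ae_restrict_of_ae_restrict_of_subset
      inter_subset_right huv)
  · intro x hx
    obtain ⟨s, hs, hi⟩ := hu.2.1 x hx
    refine ⟨s ∩ Ω, inter_mem hs self_mem_nhdsWithin, ?_⟩
    exact (hi.mono_set inter_subset_left).congr_fun_ae (ae_restrict_of_ae_restrict_of_subset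
      inter_subset_right hgh)
  · rw [← integral_congr_ae (huv.mono fun x hx => by simp only [hx] :
        (fun x => u x * fderiv ℝ φ x e) =ᵐ[volume.restrict Ω] fun x => v x * fderiv ℝ φ x e),
      ← integral_congr_ae (hgh.mono fun x hx => by simp only [hx] :
        (fun x => g x * φ x) =ᵐ[volume.restrict Ω] fun x => h x * φ x)]
    exact hu.2.2 φ hφ hc hs

theorem IsWeakDeriv.integrable_mul_fderiv (hu : IsWeakDeriv Ω e u g) {φ : E → ℝ}
    (hφ : ContDiff ℝ ∞ φ) (hc : HasCompactSupport φ) (hs : tsupport φ ⊆ Ω) :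
    Integrable fun x => u x * fderiv ℝ φ x e :=
  integrable_mul_of_tsupport_subset hu.1 (continuous_fderiv_apply_const hφ e)
    (hc.fderiv_apply ℝ e) ((tsupport_fderiv_apply_subset ℝ e).trans hs)

theorem IsWeakDeriv.integrable_mul (hu : IsWeakDeriv Ω e u g) {φ : E → ℝ}
    (hφ : ContDiff ℝ ∞ φ) (hc : HasCompactSupport φ) (hs : tsupport φ ⊆ Ω) :
    Integrable fun x => g x * φ x :=
  integrable_mul_of_tsupport_subset hu.2.1 hφ.continuous hc hs

theorem IsWeakDeriv.add (hu : IsWeakDeriv Ω e u g) (hv : IsWeakDeriv Ω e v h) :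
    IsWeakDeriv Ω e (u + v) (g + h) := by
  refine ⟨hu.1.add hv.1, hu.2.1.add hv.2.1, fun φ hφ hc hs => ?_⟩
  simp only [Pi.add_apply, add_mul]
  rw [integral_add (hu.integrable_mul_fderiv hφ hc hs).integrableOn
      (hv.integrable_mul_fderiv hφ hc hs).integrableOn,
    integral_add (hu.integrable_mul hφ hc hs).integrableOn
      (hv.integrable_mul hφ hc hs).integrableOn, hu.2.2 φ hφ hc hs, hv.2.2 φ hφ hc hs]
  ring

theorem IsWeakDeriv.neg (hu : IsWeakDeriv Ω e u g) : IsWeakDeriv Ω e (-u) (-g) := by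
  refine ⟨hu.1.neg, hu.2.1.neg, fun φ hφ hc hs => ?_⟩
  simp only [Pi.neg_apply, neg_mul, integral_neg, hu.2.2 φ hφ hc hs]

theorem IsWeakDeriv.sub (hu : IsWeakDeriv Ω e u g) (hv : IsWeakDeriv Ω e v h) :
    IsWeakDeriv Ω e (u - v) (g - h) := by
  rw [sub_eq_add_neg, sub_eq_add_neg]
  exact hu.add hv.neg

theorem isWeakDeriv_zero : IsWeakDeriv Ω e (0 : E → ℝ) 0 :=
  ⟨locallyIntegrableOn_zero, locallyIntegrableOn_zero, fun φ _ _ _ => by simp⟩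

theorem IsWeakDeriv.sum {ι : Type*} (s : Finset ι) {U G : ι → E → ℝ}
    (hU : ∀ i ∈ s, IsWeakDeriv Ω e (U i) (G i)) :
    IsWeakDeriv Ω e (∑ i ∈ s, U i) (∑ i ∈ s, G i) := by
  classical
  induction s using Finset.induction_on with
  | empty => simpa using isWeakDeriv_zero
  | insert a s ha ih =>
    rw [Finset.sum_insert ha, Finset.sum_insert ha]
    exact (hU a (by simp)).add (ih fun i hi => hU i (by simp [hi]))

theorem IsWeakDeriv.isWeakDeriv_weakDeriv (hu : WeaklyDifferentiable Ω e u) :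
    IsWeakDeriv Ω e u (weakDeriv Ω e u) := by
  rw [weakDeriv, dif_pos hu]
  exact hu.choose_spec

variable [FiniteDimensional ℝ E]

/-- The fundamental lemma of the calculus of variations, applied to the difference. This makes the
choice in `weakDeriv` harmless: any explicit weak derivative may replace it inside a norm. -/
theorem IsWeakDeriv.ae_eq (hΩ : IsOpen Ω) (hu : IsWeakDeriv Ω e u g) (hv : IsWeakDeriv Ω e v h)
    (huv : u =ᵐ[volume.restrict Ω] v) : g =ᵐ[volume.restrict Ω] h := by
  have hw := (hu.congr huv (EventuallyEq.refl _ g)).sub hv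
  have h0 : ∀ᵐ x ∂volume, x ∈ Ω → (g - h) x = 0 := by
    refine hΩ.ae_eq_zero_of_integral_contDiff_smul_eq_zero hw.2.1 fun φ hφ hc hs => ?_
    have h1 := hw.2.2 φ hφ hc hs
    simp only [sub_self, Pi.zero_apply, zero_mul, integral_zero] at h1
    rw [setIntegral_eq_integral_of_forall_compl_eq_zero] at h1
    · simpa [mul_comm] using h1
    · intro x hx
      rw [image_eq_zero_of_notMem_tsupport fun hx' => hx (hs hx'), mul_zero]
  filter_upwards [(ae_restrict_iff' hΩ.measurableSet).2 h0] with x hx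
  exact sub_eq_zero.1 hx

theorem IsWeakDeriv.weakDeriv_ae_eq (hΩ : IsOpen Ω) (hu : IsWeakDeriv Ω e u g) :
    weakDeriv Ω e u =ᵐ[volume.restrict Ω] g :=
  (IsWeakDeriv.isWeakDeriv_weakDeriv ⟨g, hu⟩).ae_eq hΩ hu (EventuallyEq.refl _ _)

theorem isWeakDeriv_of_contDiff [(volume : Measure E).IsAddHaarMeasure] {φ : E → ℝ}
    (hφ : ContDiff ℝ ∞ φ) :
    IsWeakDeriv Ω e φ (fun x => fderiv ℝ φ x e) := by
  have hφ' := continuous_fderiv_apply_const hφ e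
  refine ⟨hφ.continuous.locallyIntegrable.locallyIntegrableOn _,
    hφ'.locallyIntegrable.locallyIntegrableOn _, fun η hη hc hs => ?_⟩
  have hη' := continuous_fderiv_apply_const hη e
  rw [setIntegral_eq_integral_of_forall_compl_eq_zero,
    setIntegral_eq_integral_of_forall_compl_eq_zero]
  · exact integral_mul_fderiv_eq_neg_fderiv_mul_of_integrable
      ((hφ'.mul hη.continuous).integrable_of_hasCompactSupport hc.mul_left)
      ((hφ.continuous.mul hη').integrable_of_hasCompactSupport (hc.fderiv_apply ℝ e).mul_left)
      ((hφ.continuous.mul hη.continuous).integrable_of_hasCompactSupport hc.mul_left)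
      (fun x _ => hφ.differentiable (by simp) x) (fun x _ => hη.differentiable (by simp) x)
  · intro x hx
    rw [image_eq_zero_of_notMem_tsupport fun hx' => hx (hs hx'), mul_zero]
  · intro x hx
    rw [image_eq_zero_of_notMem_tsupport fun hx' =>
      hx (hs (tsupport_fderiv_apply_subset ℝ e hx')), mul_zero]

/-! ### Limits in weighted Lebesgue spaces -/

/-- Cauchy–Schwarz after splitting the integrand as `(U - u)√w` times `ψ/√w`. The second factor is
square integrable because `w` is continuous and positive on the compact support of `ψ`. -/
theorem tendsto_integral_mul (hΩ : IsOpen Ω) (hwc : ContinuousOn w Ω) (hw : ∀ x ∈ Ω, 0 < w x)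
    {U : ℕ → E → ℝ} (hU : ∀ k, MemL2 Ω w (U k)) (hu : MemL2 Ω w u)
    (hlim : Tendsto (fun k => ∫ x in Ω, (U k x - u x) ^ 2 * w x) atTop (𝓝 0))
    [IsLocallyFiniteMeasure (volume : Measure E)]
    (hψ : Continuous ψ) (hc : HasCompactSupport ψ) (hs : tsupport ψ ⊆ Ω) :
    Tendsto (fun k => ∫ x in Ω, U k x * ψ x) atTop (𝓝 (∫ x in Ω, u x * ψ x)) := by
  have hΩm := hΩ.measurableSet
  have hwm : AEStronglyMeasurable w (volume.restrict Ω) := hwc.aestronglyMeasurable hΩm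
  have hw0 : ∀ x ∈ Ω, 0 ≤ w x := fun x hx => (hw x hx).le
  have hint : ∀ {f : E → ℝ}, MemL2 Ω w f → IntegrableOn (fun x => f x * ψ x) Ω := fun hf =>
    (integrable_mul_of_tsupport_subset (hf.locallyIntegrableOn hΩ hwc hw)
      hψ hc hs).integrableOn
  have hq : IntegrableOn (fun x => (ψ x / √(w x)) ^ 2) Ω := by
    have h1 : IntegrableOn (fun x => (ψ x / √(w x)) ^ 2) (tsupport ψ) := by
      refine ContinuousOn.integrableOn_compact hc ?_
      refine (hψ.continuousOn.div (hwc.mono hs).sqrt fun x hx => ?_).pow 2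
      exact (Real.sqrt_pos.2 (hw x (hs hx))).ne'
    refine ((integrableOn_iff_integrable_of_support_subset fun x hx => ?_).1 h1).integrableOn
    refine subset_tsupport _ fun h0 => hx ?_
    simp [h0]
  have hψm : AEStronglyMeasurable (fun x => ψ x / √(w x)) (volume.restrict Ω) :=
    ((hψ.aemeasurable).div (hwm.aemeasurable.sqrt)).aestronglyMeasurable
  rw [tendsto_iff_norm_sub_tendsto_zero]
  have hbd : ∀ k, ‖(∫ x in Ω, U k x * ψ x) - ∫ x in Ω, u x * ψ x‖
      ≤ √((∫ x in Ω, (U k x - u x) ^ 2 * w x) * ∫ x in Ω, (ψ x / √(w x)) ^ 2) := by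
    intro k
    rw [← integral_sub (hint (hU k)) (hint hu), Real.norm_eq_abs]
    refine Real.abs_le_sqrt ?_
    have hd : MemL2 Ω w (U k - u) := (hU k).sub hΩm hwm hw0 hu
    have e1 : ∫ x in Ω, (U k x * ψ x - u x * ψ x)
        = ∫ x in Ω, ((U k x - u x) * √(w x)) * (ψ x / √(w x)) := by
      refine setIntegral_congr_fun hΩm fun x hx => ?_
      have := (Real.sqrt_pos.2 (hw x hx)).ne'
      field_simp
    have e2 : ∀ x ∈ Ω, ((U k x - u x) * √(w x)) ^ 2 = (U k x - u x) ^ 2 * w x := by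
      intro x hx
      rw [mul_pow, Real.sq_sqrt (hw0 x hx)]
    rw [e1, ← setIntegral_congr_fun hΩm e2]
    refine sq_integral_mul_le (hd.1.mul hwm.aemeasurable.sqrt.aestronglyMeasurable) hψm ?_ hq
    exact (integrableOn_congr_fun e2 hΩm).2 hd.2
  refine squeeze_zero (fun k => norm_nonneg _) hbd ?_
  have := (hlim.mul_const (∫ x in Ω, (ψ x / √(w x)) ^ 2)).sqrt
  simpa using this

/-- Both sides of the defining identity are pairings with compactly supported continuous functions,
hence pass to the limit. This serves to differentiate the traces. -/
theorem IsWeakDeriv.of_tendsto (hΩ : IsOpen Ω) (hwc : ContinuousOn w Ω) (hw : ∀ x ∈ Ω, 0 < w x)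
    [IsLocallyFiniteMeasure (volume : Measure E)]
    {U G : ℕ → E → ℝ} (hUG : ∀ k, IsWeakDeriv Ω e (U k) (G k))
    (hU : ∀ k, MemL2 Ω w (U k)) (hu : MemL2 Ω w u)
    (hG : ∀ k, MemL2 Ω w (G k)) (hg : MemL2 Ω w g)
    (hlimU : Tendsto (fun k => ∫ x in Ω, (U k x - u x) ^ 2 * w x) atTop (𝓝 0))
    (hlimG : Tendsto (fun k => ∫ x in Ω, (G k x - g x) ^ 2 * w x) atTop (𝓝 0)) :
    IsWeakDeriv Ω e u g := by
  refine ⟨hu.locallyIntegrableOn hΩ hwc hw, hg.locallyIntegrableOn hΩ hwc hw,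
    fun φ hφ hc hs => ?_⟩
  have h1 := tendsto_integral_mul hΩ hwc hw hU hu hlimU (continuous_fderiv_apply_const hφ e)
    (hc.fderiv_apply ℝ e) ((tsupport_fderiv_apply_subset ℝ e).trans hs)
  have h2 := (tendsto_integral_mul hΩ hwc hw hG hg hlimG hφ.continuous hc hs).neg
  refine tendsto_nhds_unique h1 (h2.congr fun k => ?_)
  exact ((hUG k).2.2 φ hφ hc hs).symm

/-- From `(u - v)² ≤ 2(U - u)² + 2(U - v)²` the weighted integral of `(u - v)²` vanishes, and the
weight is positive. Uniqueness of traces rests on this. -/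
theorem ae_eq_of_tendsto (hΩ : MeasurableSet Ω) (hw : ∀ x ∈ Ω, 0 < w x)
    (hwm : AEStronglyMeasurable w (volume.restrict Ω))
    {U : ℕ → E → ℝ} (hU : ∀ k, MemL2 Ω w (U k)) (hu : MemL2 Ω w u) (hv : MemL2 Ω w v)
    (hlimu : Tendsto (fun k => ∫ x in Ω, (U k x - u x) ^ 2 * w x) atTop (𝓝 0))
    (hlimv : Tendsto (fun k => ∫ x in Ω, (U k x - v x) ^ 2 * w x) atTop (𝓝 0)) :
    u =ᵐ[volume.restrict Ω] v := by
  have hw0 : ∀ x ∈ Ω, 0 ≤ w x := fun x hx => (hw x hx).le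
  have hint : ∀ {f h : E → ℝ}, MemL2 Ω w f → MemL2 Ω w h →
      IntegrableOn (fun x => (f x - h x) ^ 2 * w x) Ω := fun hf hh => (hf.sub hΩ hwm hw0 hh).2
  have hnn : ∀ f h : E → ℝ, 0 ≤ᵐ[volume.restrict Ω] fun x => (f x - h x) ^ 2 * w x :=
    fun f h => (ae_restrict_mem hΩ).mono fun x hx => mul_nonneg (sq_nonneg _) (hw0 x hx)
  have hle : ∀ k, ∫ x in Ω, (u x - v x) ^ 2 * w x
      ≤ 2 * (∫ x in Ω, (U k x - u x) ^ 2 * w x) + 2 * ∫ x in Ω, (U k x - v x) ^ 2 * w x := by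
    intro k
    rw [← integral_const_mul, ← integral_const_mul,
      ← integral_add ((hint (hU k) hu).const_mul 2) ((hint (hU k) hv).const_mul 2)]
    refine integral_mono_ae (hint hu hv)
      (((hint (hU k) hu).const_mul 2).add ((hint (hU k) hv).const_mul 2)) ?_
    filter_upwards [ae_restrict_mem hΩ] with x hx
    nlinarith [mul_nonneg (sq_nonneg (2 * U k x - u x - v x)) (hw0 x hx)]
  have hz : ∫ x in Ω, (u x - v x) ^ 2 * w x = 0 := by
    refine le_antisymm ?_ (integral_nonneg_of_ae (hnn u v))
    refine ge_of_tendsto' (x := atTop) ?_ hle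
    simpa using (hlimu.const_mul 2).add (hlimv.const_mul 2)
  rw [integral_eq_zero_iff_of_nonneg_ae (hnn u v) (hint hu hv)] at hz
  filter_upwards [hz, ae_restrict_mem hΩ] with x hx hxΩ
  have := (mul_eq_zero.1 hx).resolve_right (hw x hxΩ).ne'
  exact sub_eq_zero.1 (pow_eq_zero_iff two_ne_zero |>.1 this)

end Topological

end General

/-! ### The rectangle and its slices -/

theorem isOpen_Q (Θ : ℝ) : IsOpen (Q Θ) := isOpen_Ioo.prod isOpen_Ioo

theorem measurableSet_Q (Θ : ℝ) : MeasurableSet (Q Θ) := (isOpen_Q Θ).measurableSet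

theorem volume_restrict_Q (Θ : ℝ) : (volume.restrict (Q Θ) : Measure (ℝ × ℝ))
    = (volume.restrict (Ioo (0 : ℝ) 1)).prod (volume.restrict (Ioo 0 Θ)) := by
  rw [Q, Measure.prod_restrict]
  rfl

theorem wr_pos {Θ : ℝ} : ∀ p ∈ Q Θ, 0 < wr p := fun _ hp => hp.1.1

theorem wr_nonneg {Θ : ℝ} : ∀ p ∈ Q Θ, 0 ≤ wr p := fun p hp => (wr_pos p hp).le

theorem wrInv_nonneg {Θ : ℝ} : ∀ p ∈ Q Θ, 0 ≤ wrInv p := fun p hp =>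
  one_div_nonneg.2 (wr_nonneg p hp)

theorem wr_le_wrInv {Θ : ℝ} : ∀ p ∈ Q Θ, wr p ≤ wrInv p := by
  intro p hp
  have h0 : 0 < p.1 := hp.1.1
  have h1 : p.1 < 1 := hp.1.2
  rw [wr, wrInv, le_div_iff₀ h0]
  nlinarith

theorem continuous_wr : Continuous wr := continuous_fst

theorem aestronglyMeasurable_wr {μ : Measure (ℝ × ℝ)} : AEStronglyMeasurable wr μ :=
  continuous_wr.aestronglyMeasurable

theorem aestronglyMeasurable_wrInv {μ : Measure (ℝ × ℝ)} : AEStronglyMeasurable wrInv μ :=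
  (measurable_const.div measurable_fst).aestronglyMeasurable

theorem MemL2.wr_of_wrInv {Θ : ℝ} {v : ℝ × ℝ → ℝ} (hv : MemL2 (Q Θ) wrInv v) :
    MemL2 (Q Θ) wr v :=
  hv.mono_weight (measurableSet_Q Θ) aestronglyMeasurable_wr wr_nonneg wr_le_wrInv

theorem MemL2.wr_locallyIntegrableOn {Θ : ℝ} {v : ℝ × ℝ → ℝ} (hv : MemL2 (Q Θ) wr v) :
    LocallyIntegrableOn v (Q Θ) :=
  hv.locallyIntegrableOn (isOpen_Q Θ) continuous_wr.continuousOn wr_pos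

/-- Slices are taken half-open throughout, to match interval integrals and the elements of a
partition, which tile `Ioc 0 Θ` exactly. -/
theorem restrict_Ioc_eq (a b : ℝ) :
    (volume.restrict (Ioc a b) : Measure ℝ) = volume.restrict (Ioo a b) :=
  Measure.restrict_congr_set Ioo_ae_eq_Ioc.symm

theorem ae_Q_iff_slices {Θ : ℝ} {P : ℝ × ℝ → Prop} (h : ∀ᵐ p ∂volume.restrict (Q Θ), P p) :
    ∀ᵐ r ∂volume.restrict (Ioo (0 : ℝ) 1), ∀ᵐ θ ∂volume.restrict (Ioc 0 Θ), P (r, θ) := by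
  rw [volume_restrict_Q] at h
  rw [restrict_Ioc_eq]
  exact Measure.ae_ae_of_ae_prod h

/-- Fubini: on a slice the weight is the positive constant `r` and can be divided out. -/
theorem MemL2.ae_memLp_slice {Θ : ℝ} {v : ℝ × ℝ → ℝ} (hv : MemL2 (Q Θ) wr v) :
    ∀ᵐ r ∂volume.restrict (Ioo (0 : ℝ) 1),
      MemLp (fun θ => v (r, θ)) 2 (volume.restrict (Ioc 0 Θ)) := by
  have h1 := hv.1
  have h2 := hv.2
  rw [IntegrableOn, volume_restrict_Q] at h2
  rw [volume_restrict_Q] at h1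
  rw [restrict_Ioc_eq]
  filter_upwards [h2.prod_right_ae, h1.prodMk_left, ae_restrict_mem measurableSet_Ioo]
    with r hr hm hr0
  refine (memLp_two_iff_integrable_sq hm).2 ((hr.mul_const r⁻¹).congr (ae_of_all _ fun θ => ?_))
  simp only [wr]
  rw [mul_assoc, mul_inv_cancel₀ hr0.1.ne', mul_one]

/-- Integration of a slicewise inequality over the rectangle. -/
theorem integrableOn_Q_of_slices {Θ K : ℝ} {F G : ℝ × ℝ → ℝ}
    (hF : AEStronglyMeasurable F (volume.restrict (Q Θ))) (hF0 : ∀ p ∈ Q Θ, 0 ≤ F p)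
    (hG : IntegrableOn G (Q Θ))
    (h : ∀ᵐ r ∂volume.restrict (Ioo (0 : ℝ) 1),
      IntegrableOn (fun θ => F (r, θ)) (Ioc 0 Θ) ∧
      ∫ θ in Ioc 0 Θ, F (r, θ) ≤ K * ∫ θ in Ioc 0 Θ, G (r, θ)) :
    IntegrableOn F (Q Θ) ∧ ∫ p in Q Θ, F p ≤ K * ∫ p in Q Θ, G p := by
  rw [restrict_Ioc_eq] at h
  simp only [IntegrableOn, restrict_Ioc_eq] at h
  rw [volume_restrict_Q] at hF
  rw [IntegrableOn, volume_restrict_Q] at hG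
  have hGi := hG.integral_prod_left
  have hnn : ∀ᵐ r ∂volume.restrict (Ioo (0 : ℝ) 1),
      0 ≤ᵐ[volume.restrict (Ioo 0 Θ)] fun θ => F (r, θ) := by
    filter_upwards [ae_restrict_mem measurableSet_Ioo] with r hr
    filter_upwards [ae_restrict_mem measurableSet_Ioo] with θ hθ
    exact hF0 _ ⟨hr, hθ⟩
  have hFi : Integrable F ((volume.restrict (Ioo (0 : ℝ) 1)).prod (volume.restrict (Ioo 0 Θ))) := by
    rw [integrable_prod_iff hF]
    refine ⟨h.mono fun r hr => hr.1, ?_⟩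
    refine (hGi.const_mul K).mono' hF.norm.integral_prod_right' ?_
    filter_upwards [h, hnn] with r hr hn
    rw [Real.norm_of_nonneg (integral_nonneg fun _ => norm_nonneg _)]
    refine le_trans (le_of_eq (integral_congr_ae ?_)) hr.2
    exact hn.mono fun θ hθ => Real.norm_of_nonneg hθ
  refine ⟨by rwa [IntegrableOn, volume_restrict_Q], ?_⟩
  rw [volume_restrict_Q, integral_prod _ hFi, integral_prod _ hG, ← integral_const_mul]
  exact integral_mono_ae hFi.integral_prod_left (hGi.const_mul K) (h.mono fun r hr => hr.2)

/-- The weighted version of `integrableOn_Q_of_slices` for squares. -/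
theorem MemL2.of_slices {Θ K : ℝ} {v g : ℝ × ℝ → ℝ} {ρ : ℝ → ℝ}
    (hρm : Measurable ρ) (hρ : ∀ r ∈ Ioo (0 : ℝ) 1, 0 ≤ ρ r)
    (hv : AEStronglyMeasurable v (volume.restrict (Q Θ)))
    (hg : MemL2 (Q Θ) (fun p => ρ p.1) g)
    (h : ∀ᵐ r ∂volume.restrict (Ioo (0 : ℝ) 1),
      MemLp (fun θ => v (r, θ)) 2 (volume.restrict (Ioc 0 Θ)) ∧
      ∫ θ in Ioc 0 Θ, v (r, θ) ^ 2 ≤ K * ∫ θ in Ioc 0 Θ, g (r, θ) ^ 2) :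
    MemL2 (Q Θ) (fun p => ρ p.1) v ∧
      ∫ p in Q Θ, v p ^ 2 * ρ p.1 ≤ K * ∫ p in Q Θ, g p ^ 2 * ρ p.1 := by
  have hρ' : AEStronglyMeasurable (fun p : ℝ × ℝ => ρ p.1) (volume.restrict (Q Θ)) :=
    (hρm.comp measurable_fst).aestronglyMeasurable
  have := integrableOn_Q_of_slices (K := K) (F := fun p => v p ^ 2 * ρ p.1)
    (G := fun p => g p ^ 2 * ρ p.1) ((hv.pow 2).mul hρ')
    (fun p hp => mul_nonneg (sq_nonneg _) (hρ _ hp.1)) hg.2 (by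
      filter_upwards [h, ae_restrict_mem measurableSet_Ioo] with r hr hr0
      refine ⟨hr.1.integrable_sq.mul_const _, ?_⟩
      -- The weight is constant on the slice, so an unweighted slice inequality gives the weighted
      -- one with the same `K`, whatever the radial weight.
      rw [integral_mul_const, integral_mul_const, ← mul_assoc]
      exact mul_le_mul_of_nonneg_right hr.2 (hρ r hr0))
  exact ⟨⟨hv, this.1⟩, this.2⟩

/-! ### Angular primitives -/

theorem intervalIntegrable_of_memLp {f : ℝ → ℝ} {α β : ℝ}
    (hf : MemLp f 2 (volume.restrict (Ioc α β))) (hαβ : α ≤ β) {a b : ℝ}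
    (ha : a ∈ Icc α β) (hb : b ∈ Icc α β) : IntervalIntegrable f volume a b := by
  have h1 : IntervalIntegrable f volume α β :=
    (intervalIntegrable_iff_integrableOn_Ioc_of_le hαβ).2 (hf.integrable (by norm_num))
  refine h1.mono_set ?_
  rw [uIcc_of_le hαβ]
  exact uIcc_subset_Icc ha hb

/-- Cauchy–Schwarz against the constant `1`, with the length of the interval bounded by `β - α`. The
end points may come in either order, as needed for primitives started at an interior angle. -/
theorem sq_intervalIntegral_le {f : ℝ → ℝ} {α β : ℝ}
    (hf : MemLp f 2 (volume.restrict (Ioc α β))) {a b : ℝ}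
    (ha : a ∈ Icc α β) (hb : b ∈ Icc α β) :
    (∫ t in a..b, f t) ^ 2 ≤ (β - α) * ∫ t in Ioc α β, f t ^ 2 := by
  wlog hab : a ≤ b generalizing a b
  · rw [intervalIntegral.integral_symm, neg_sq]
    exact this hb ha (le_of_not_ge hab)
  have hsub : Ioc a b ⊆ Ioc α β := Ioc_subset_Ioc ha.1 hb.2
  have hf' : MemLp f 2 (volume.restrict (Ioc a b)) := hf.mono_measure (Measure.restrict_mono_set _ hsub)
  have h1 := sq_integral_mul_le hf'.1 aestronglyMeasurable_const hf'.integrable_sq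
    (g := fun _ => (1 : ℝ)) (integrable_const _)
  rw [intervalIntegral.integral_of_le hab]
  simp only [mul_one, one_pow, integral_const, MeasurableSet.univ, measureReal_restrict_apply,
    univ_inter, Real.volume_real_Ioc_of_le hab, smul_eq_mul] at h1
  have h2 : ∫ t in Ioc a b, f t ^ 2 ≤ ∫ t in Ioc α β, f t ^ 2 :=
    setIntegral_mono_set hf.integrable_sq (ae_of_all _ fun _ => sq_nonneg _)
      hsub.eventuallyLE
  have h3 : 0 ≤ ∫ t in Ioc a b, f t ^ 2 := integral_nonneg fun _ => sq_nonneg _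
  have h4 := ha.1
  have h5 := hb.2
  nlinarith

theorem memLp_of_sq_le_const {f : ℝ → ℝ} {α β K : ℝ} (hαβ : α ≤ β)
    (hf : AEStronglyMeasurable f (volume.restrict (Ioc α β)))
    (hK : ∀ᵐ t ∂volume.restrict (Ioc α β), f t ^ 2 ≤ K) :
    MemLp f 2 (volume.restrict (Ioc α β)) ∧ ∫ t in Ioc α β, f t ^ 2 ≤ (β - α) * K := by
  have hi : Integrable (fun t => f t ^ 2) (volume.restrict (Ioc α β)) := by
    refine (integrable_const K).mono' (hf.pow 2) (hK.mono fun t ht => ?_)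
    rwa [Real.norm_of_nonneg (sq_nonneg _)]
  refine ⟨(memLp_two_iff_integrable_sq hf).2 hi, ?_⟩
  refine (integral_mono_ae hi (integrable_const K) hK).trans (le_of_eq ?_)
  simp [Real.volume_real_Ioc_of_le hαβ]

/-- The primitive in the angular variable. -/
noncomputable def angularPrimitive (g : ℝ × ℝ → ℝ) (p : ℝ × ℝ) : ℝ := ∫ t in (0 : ℝ)..p.2, g (p.1, t)

/-- The variable limits are absorbed into the indicator of a measurable set in the product, after
which measurability of parameter integrals over the whole line applies. -/
theorem stronglyMeasurable_integral_Ioc {g : ℝ × ℝ → ℝ} (hg : StronglyMeasurable g)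
    {α : Type*} [MeasurableSpace α] {a b c : α → ℝ} (ha : Measurable a) (hb : Measurable b)
    (hc : Measurable c) :
    StronglyMeasurable fun x => ∫ t in Ioc (a x) (b x), g (c x, t) := by
  have h1 : StronglyMeasurable fun q : α × ℝ =>
      {q : α × ℝ | a q.1 < q.2 ∧ q.2 ≤ b q.1}.indicator (fun q => g (c q.1, q.2)) q := by
    refine StronglyMeasurable.indicator ?_ ?_
    · exact hg.comp_measurable ((hc.comp measurable_fst).prodMk measurable_snd)
    · exact (measurableSet_lt (ha.comp measurable_fst) measurable_snd).inter
        (measurableSet_le measurable_snd (hb.comp measurable_fst))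
  convert (h1.integral_prod_right' (ν := volume)) using 2 with x
  rw [← integral_indicator measurableSet_Ioc]
  rfl

theorem stronglyMeasurable_intervalIntegral {g : ℝ × ℝ → ℝ} (hg : StronglyMeasurable g)
    {α : Type*} [MeasurableSpace α] {a b c : α → ℝ} (ha : Measurable a) (hb : Measurable b)
    (hc : Measurable c) :
    StronglyMeasurable fun x => ∫ t in (a x)..(b x), g (c x, t) :=
  (stronglyMeasurable_integral_Ioc hg ha hb hc).sub (stronglyMeasurable_integral_Ioc hg hb ha hc)

theorem stronglyMeasurable_angularPrimitive {g : ℝ × ℝ → ℝ} (hg : StronglyMeasurable g) :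
    StronglyMeasurable (angularPrimitive g) :=
  stronglyMeasurable_intervalIntegral hg measurable_const measurable_snd measurable_fst

theorem memL2_angularPrimitive {Θ : ℝ} (hΘ : 0 < Θ) {g : ℝ × ℝ → ℝ} (hg : StronglyMeasurable g)
    (hg2 : MemL2 (Q Θ) wr g) : MemL2 (Q Θ) wr (angularPrimitive g) := by
  have hm := stronglyMeasurable_angularPrimitive hg
  refine (MemL2.of_slices (K := Θ ^ 2) (ρ := fun r => r) measurable_id (fun r hr => hr.1.le)
    hm.aestronglyMeasurable hg2 ?_).1
  filter_upwards [hg2.ae_memLp_slice] with r hr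
  have := memLp_of_sq_le_const hΘ.le (f := fun θ => angularPrimitive g (r, θ))
    (K := Θ * ∫ θ in Ioc 0 Θ, g (r, θ) ^ 2)
    (hm.comp_measurable measurable_prodMk_left).aestronglyMeasurable (by
      filter_upwards [ae_restrict_mem measurableSet_Ioc] with θ hθ
      have := sq_intervalIntegral_le hr (a := 0) (b := θ) ⟨le_rfl, hΘ.le⟩ ⟨hθ.1.le, hθ.2⟩
      simpa [angularPrimitive] using this)
  refine ⟨this.1, this.2.trans (le_of_eq ?_)⟩
  ring

theorem fderiv_apply_dirTheta {φ : ℝ × ℝ → ℝ} (hφ : ContDiff ℝ ∞ φ) (r θ : ℝ) :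
    HasDerivAt (fun t => φ (r, t)) (fderiv ℝ φ (r, θ) dirTheta) θ := by
  have h1 : HasFDerivAt φ (fderiv ℝ φ (r, θ)) (r, θ) :=
    (hφ.differentiable (by simp) _).hasFDerivAt
  exact h1.comp_hasDerivAt θ ((hasDerivAt_const θ r).prodMk (hasDerivAt_id θ))

theorem fderiv_apply_dirR {φ : ℝ × ℝ → ℝ} (hφ : ContDiff ℝ ∞ φ) (r θ : ℝ) :
    HasDerivAt (fun t => φ (t, θ)) (fderiv ℝ φ (r, θ) dirR) r := by
  have h1 : HasFDerivAt φ (fderiv ℝ φ (r, θ)) (r, θ) :=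
    (hφ.differentiable (by simp) _).hasFDerivAt
  exact h1.comp_hasDerivAt r ((hasDerivAt_id r).prodMk (hasDerivAt_const r θ))

/-- Integration by parts of an absolutely continuous function against a function vanishing at the
end points. -/
theorem integral_primitive_mul_deriv {f φ φ' : ℝ → ℝ} {a b k : ℝ} (hab : a ≤ b)
    (hf : IntervalIntegrable f volume a b) (hφ : ∀ x, HasDerivAt φ (φ' x) x)
    (hφ' : Continuous φ') (ha : φ a = 0) (hb : φ b = 0) :
    ∫ x in Ioc a b, (k + ∫ t in a..x, f t) * φ' x = -∫ x in Ioc a b, f x * φ x := by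
  have hder : deriv φ = φ' := funext fun x => (hφ x).deriv
  have hφc : ContDiff ℝ 1 φ :=
    contDiff_one_iff_deriv.2 ⟨fun x => (hφ x).differentiableAt, by rwa [hder]⟩
  have hAC : AbsolutelyContinuousOnInterval (fun x => k + ∫ t in a..x, f t) a b :=
    (contDiffOn_const (c := k)).absolutelyContinuousOnInterval.add
      (hf.absolutelyContinuousOnInterval_intervalIntegral left_mem_uIcc)
  have h := hAC.integral_mul_deriv_eq_deriv_mul hφc.contDiffOn.absolutelyContinuousOnInterval
  rw [hder, ha, hb, mul_zero, mul_zero, sub_zero, zero_sub] at h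
  rw [← intervalIntegral.integral_of_le hab, ← intervalIntegral.integral_of_le hab, h]
  congr 1
  refine intervalIntegral.integral_congr_ae ?_
  filter_upwards [hf.ae_hasDerivAt_integral] with x hx hxm
  rw [((hx (uIoc_subset_uIcc hxm) a left_mem_uIcc).const_add k).deriv]

/-- Fubini reduces the claim to integration by parts on almost every slice. The test function
vanishes at `θ = 0` and `θ = Θ`, so there are no boundary terms and the constant `c r` drops out; no
regularity of `c` is needed. -/
theorem isWeakDeriv_of_ae_primitive {Θ : ℝ} (hΘ : 0 < Θ) {v g : ℝ × ℝ → ℝ} {c : ℝ → ℝ}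
    (hv : MemL2 (Q Θ) wr v) (hg : MemL2 (Q Θ) wr g)
    (h : ∀ᵐ r ∂volume.restrict (Ioo (0 : ℝ) 1), ∀ᵐ θ ∂volume.restrict (Ioc 0 Θ),
      v (r, θ) = c r + angularPrimitive g (r, θ)) :
    IsWeakDeriv (Q Θ) dirTheta v g := by
  refine ⟨hv.wr_locallyIntegrableOn, hg.wr_locallyIntegrableOn, fun φ hφ hc hs => ?_⟩
  have hi1 : IntegrableOn (fun x => v x * fderiv ℝ φ x dirTheta) (Q Θ) :=
    (integrable_mul_of_tsupport_subset hv.wr_locallyIntegrableOn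
    (continuous_fderiv_apply_const hφ _) (hc.fderiv_apply ℝ _)
    ((tsupport_fderiv_apply_subset ℝ _).trans hs)).integrableOn
  have hi2 : IntegrableOn (fun x => g x * φ x) (Q Θ) :=
    (integrable_mul_of_tsupport_subset hg.wr_locallyIntegrableOn hφ.continuous hc hs).integrableOn
  rw [IntegrableOn, volume_restrict_Q] at hi1 hi2
  rw [volume_restrict_Q, integral_prod _ hi1, integral_prod _ hi2, ← integral_neg]
  refine integral_congr_ae ?_
  filter_upwards [h, hg.ae_memLp_slice] with r hr hgr
  have hz : ∀ θ, θ ∉ Ioo 0 Θ → φ (r, θ) = 0 := fun θ hθ =>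
    image_eq_zero_of_notMem_tsupport fun h' => hθ (hs h').2
  have := integral_primitive_mul_deriv (k := c r) hΘ.le
    (intervalIntegrable_of_memLp hgr hΘ.le ⟨le_rfl, hΘ.le⟩ ⟨hΘ.le, le_rfl⟩)
    (fun θ => fderiv_apply_dirTheta hφ r θ)
    ((continuous_fderiv_apply_const hφ _).comp (by fun_prop)) (hz 0 (by simp)) (hz Θ (by simp))
  simp only [← restrict_Ioc_eq]
  rw [← this]
  exact integral_congr_ae (hr.mono fun θ hθ => by simp only [hθ, angularPrimitive])

/-! ### Functions without angular dependence -/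

theorem exists_Icc_of_isCompact_subset_Ioo {K : Set ℝ} {a b : ℝ} (hK : IsCompact K) (hab : a < b)
    (h : K ⊆ Ioo a b) : ∃ c d, a < c ∧ d < b ∧ K ⊆ Icc c d := by
  rcases K.eq_empty_or_nonempty with rfl | hne
  · exact ⟨(a + b) / 2, (a + b) / 2, by linarith, by linarith, empty_subset _⟩
  · obtain ⟨c, hc⟩ := hK.exists_isLeast hne
    obtain ⟨d, hd⟩ := hK.exists_isGreatest hne
    exact ⟨c, d, (h hc.1).1, (h hd.1).2, fun x hx => ⟨hc.2 hx, hd.2 hx⟩⟩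

/-- The primitive is the convolution in the angle of `ζ(r, ·)` with the Heaviside function.
Smoothness jointly in `(r, θ)` then follows from smoothness of convolutions with a parameter, as the
supports in `s` lie in one compact interval. -/
theorem contDiff_integral_of_support {ζ : ℝ × ℝ → ℝ} (hζ : ContDiff ℝ ∞ ζ) {a b : ℝ}
    (h0 : ∀ r s, s ∉ Icc a b → ζ (r, s) = 0) :
    ContDiff ℝ ∞ fun p : ℝ × ℝ => ∫ s in a..p.2, ζ (p.1, s) := by
  have h1 := contDiffOn_convolution_right_with_param (μ := (volume : Measure ℝ)) (n := ⊤)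
    (ContinuousLinearMap.mul ℝ ℝ) (f := (Ioi (0 : ℝ)).indicator fun _ => (1 : ℝ))
    (g := fun r s => ζ (r, s)) (s := univ) (k := Icc a b) isOpen_univ isCompact_Icc
    (fun r s _ hs => h0 r s hs)
    ((locallyIntegrable_const (1 : ℝ)).indicator measurableSet_Ioi) hζ.contDiffOn
  rw [univ_prod_univ, contDiffOn_univ] at h1
  convert h1 using 1
  funext p
  obtain ⟨r, θ⟩ := p
  rw [convolution_def, ← integral_sub_left_eq_self _ volume θ]
  simp only [sub_sub_cancel, ContinuousLinearMap.mul_apply']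
  have h2 : ∀ s, (Ioi (0 : ℝ)).indicator (fun _ => (1 : ℝ)) (θ - s) * ζ (r, s)
      = (Iio θ).indicator (fun s => ζ (r, s)) s := by
    intro s
    by_cases hs : s < θ
    · rw [indicator_of_mem (by simpa using hs), indicator_of_mem (by simpa using hs), one_mul]
    · rw [indicator_of_notMem (by simpa using hs), indicator_of_notMem (by simpa using hs),
        zero_mul]
  simp only [h2]
  rw [integral_indicator measurableSet_Iio]
  rcases le_total a θ with h | h
  · rw [intervalIntegral.integral_of_le h, integral_Ioc_eq_integral_Ioo]
    refine (setIntegral_eq_of_subset_of_ae_sdiff_eq_zero measurableSet_Iio.nullMeasurableSet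
      Ioo_subset_Iio_self ?_).symm
    -- The hypothesis allows `ζ` to be nonzero at `a` itself, which is discarded as a null set.
    filter_upwards [(measure_eq_zero_iff_ae_notMem.1 (measure_singleton a) :
      ∀ᵐ x : ℝ, x ∉ ({a} : Set ℝ))] with s hsa hs
    refine h0 r s fun hs' => hs.2 ⟨lt_of_le_of_ne hs'.1 ?_, hs.1⟩
    exact fun e => hsa e.symm
  · rw [intervalIntegral.integral_of_ge h, integral_Ioc_eq_integral_Ioo,
      setIntegral_eq_zero_of_forall_eq_zero, setIntegral_eq_zero_of_forall_eq_zero, neg_zero]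
    · exact fun s hs => h0 r s fun hs' => absurd (lt_of_lt_of_le (mem_Iio.1 hs) h) (not_lt.2 hs'.1)
    · exact fun s hs => h0 r s fun hs' => absurd hs.2 (not_lt.2 hs'.1)

theorem fderiv_integral_dirTheta {ζ : ℝ × ℝ → ℝ} (hζ : ContDiff ℝ ∞ ζ) {a b : ℝ}
    (h0 : ∀ r s, s ∉ Icc a b → ζ (r, s) = 0) (p : ℝ × ℝ) :
    fderiv ℝ (fun p : ℝ × ℝ => ∫ s in a..p.2, ζ (p.1, s)) p dirTheta = ζ p := by
  have h1 := fderiv_apply_dirTheta (contDiff_integral_of_support hζ h0) p.1 p.2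
  have hc : Continuous fun s => ζ (p.1, s) := hζ.continuous.comp (by fun_prop)
  exact h1.unique (hc.integral_hasStrictDerivAt a p.2).hasDerivAt

/-- A function whose weak angular derivative vanishes depends on the radius only. -/
theorem IsWeakDeriv.exists_radial {Θ : ℝ} (hΘ : 0 < Θ) {f : ℝ × ℝ → ℝ} (hfm : StronglyMeasurable f)
    (hf : MemL2 (Q Θ) wr f) (hd : IsWeakDeriv (Q Θ) dirTheta f 0) :
    ∃ c : ℝ → ℝ, StronglyMeasurable c ∧ ∀ᵐ p ∂volume.restrict (Q Θ), f p = c p.1 := by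
  -- A bump of integral one whose support `[Θ/6, 5Θ/6]` stays inside `(0, Θ)`.
  let B : ContDiffBump (Θ / 2) := ⟨Θ / 4, Θ / 3, by positivity, by linarith⟩
  set η : ℝ → ℝ := B.normed volume with hη
  have hηc : ContDiff ℝ ∞ η := B.contDiff_normed
  have hηi : ∫ t, η t = 1 := B.integral_normed
  have hηs : tsupport η ⊆ Icc (Θ / 6) (5 * Θ / 6) := by
    rw [hη, B.tsupport_normed_eq, Real.closedBall_eq_Icc]
    exact Icc_subset_Icc (by simp only [B]; linarith) (by simp only [B]; linarith)
  have hη0 : ∀ t, t ∉ Icc (Θ / 6) (5 * Θ / 6) → η t = 0 := fun t ht =>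
    image_eq_zero_of_notMem_tsupport fun h => ht (hηs h)
  have hηm : MemLp η 2 (volume.restrict (Ioc 0 Θ)) :=
    (hηc.continuous.memLp_of_hasCompactSupport B.hasCompactSupport_normed).restrict _
  -- The angular average of `f` against `η`: the only possible candidate, since it reproduces any
  -- function of `r` alone.
  let c : ℝ → ℝ := fun r => ∫ t in Ioc 0 Θ, f (r, t) * η t
  have hcm : StronglyMeasurable c := by
    refine StronglyMeasurable.integral_prod_right' (f := fun p : ℝ × ℝ => f p * η p.2) ?_
    exact hfm.mul (hηc.continuous.stronglyMeasurable.comp_measurable measurable_snd)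
  have hcQ : MemL2 (Q Θ) wr fun p : ℝ × ℝ => c p.1 := by
    refine (MemL2.of_slices (K := Θ * ∫ t in Ioc 0 Θ, η t ^ 2) (ρ := fun r => r) measurable_id
      (fun r hr => hr.1.le) (hcm.comp_measurable measurable_fst).aestronglyMeasurable hf ?_).1
    filter_upwards [hf.ae_memLp_slice] with r hr
    have := memLp_of_sq_le_const hΘ.le (f := fun _ => c r) aestronglyMeasurable_const
      (ae_of_all _ fun _ => sq_integral_mul_le hr.1 hηm.1 hr.integrable_sq hηm.integrable_sq)
    refine ⟨this.1, this.2.trans (le_of_eq ?_)⟩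
    ring
  refine ⟨c, hcm, ?_⟩
  have hsub : MemL2 (Q Θ) wr (f - fun p : ℝ × ℝ => c p.1) :=
    hf.sub (measurableSet_Q Θ) aestronglyMeasurable_wr wr_nonneg hcQ
  have hloc := hsub.wr_locallyIntegrableOn
  -- Given a test function `φ`, put `Φ(r) = ∫ φ(r, s) ds` and `ζ = φ - η(θ) Φ(r)`. Each slice of `ζ`
  -- has integral zero, so its angular primitive `Z` is again a test function and the hypothesis
  -- gives `∫ f ζ = 0`. By Fubini this integral is `∫ (f - c) φ`.
  have hmain : ∀ᵐ p ∂(volume : Measure (ℝ × ℝ)), p ∈ Q Θ → (f - fun p : ℝ × ℝ => c p.1) p = 0 := by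
    refine (isOpen_Q Θ).ae_eq_zero_of_integral_contDiff_smul_eq_zero hloc fun φ hφ hc hs => ?_
    obtain ⟨r1, r2, hr1, hr2, hK1⟩ := exists_Icc_of_isCompact_subset_Ioo
      (hc.isCompact.image continuous_fst) zero_lt_one (by
        rintro _ ⟨p, hp, rfl⟩; exact (hs hp).1)
    obtain ⟨s1, s2, hs1, hs2, hK2⟩ := exists_Icc_of_isCompact_subset_Ioo
      (hc.isCompact.image continuous_snd) hΘ (by
        rintro _ ⟨p, hp, rfl⟩; exact (hs hp).2)
    -- `[a, b]` contains both the angular extent of the support of `φ` and the support of `η`, and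
    -- lies in `(0, Θ)`.
    set a := min s1 (Θ / 6) with ha
    set b := max s2 (5 * Θ / 6) with hb
    have ha0 : 0 < a := lt_min hs1 (by linarith)
    have hbΘ : b < Θ := max_lt hs2 (by linarith)
    have hφ1 : ∀ r s, r ∉ Icc r1 r2 → φ (r, s) = 0 := fun r s hr =>
      image_eq_zero_of_notMem_tsupport fun h => hr (hK1 ⟨_, h, rfl⟩)
    have hφ2 : ∀ r s, s ∉ Icc a b → φ (r, s) = 0 := fun r s hr =>
      image_eq_zero_of_notMem_tsupport fun h =>
        hr (Icc_subset_Icc (min_le_left _ _) (le_max_left _ _) (hK2 ⟨_, h, rfl⟩))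
    have hη2 : ∀ s, s ∉ Icc a b → η s = 0 := fun s hs =>
      hη0 s fun h => hs (Icc_subset_Icc (min_le_right _ _) (le_max_right _ _) h)
    have hab : a ≤ b := (min_le_right _ _).trans (le_trans (by linarith) (le_max_right _ _))
    let Φ : ℝ → ℝ := fun r => ∫ s in a..b, φ (r, s)
    have hΦ : ContDiff ℝ ∞ Φ := (contDiff_integral_of_support hφ hφ2).comp
      (contDiff_id.prodMk contDiff_const)
    let ζ : ℝ × ℝ → ℝ := fun p => φ p - η p.2 * Φ p.1
    have hζ : ContDiff ℝ ∞ ζ :=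
      hφ.sub ((hηc.comp contDiff_snd).mul (hΦ.comp contDiff_fst))
    have hζ0 : ∀ r s, s ∉ Icc a b → ζ (r, s) = 0 := fun r s h => by
      simp only [ζ, hφ2 r s h, hη2 s h, zero_mul, sub_zero]
    have hζ1 : ∀ r s, r ∉ Icc r1 r2 → ζ (r, s) = 0 := fun r s h => by
      simp only [ζ, Φ, hφ1 r _ h, intervalIntegral.integral_zero, mul_zero, sub_zero]
    have hηab : ∫ s in a..b, η s = 1 := by
      rw [intervalIntegral.integral_of_le hab, ← integral_Icc_eq_integral_Ioc,
        setIntegral_eq_integral_of_forall_compl_eq_zero hη2, hηi]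
    let Z : ℝ × ℝ → ℝ := fun p => ∫ s in a..p.2, ζ (p.1, s)
    have hζc : ∀ r, Continuous fun s => ζ (r, s) := fun r => hζ.continuous.comp (by fun_prop)
    have hZb : ∀ r, ∫ s in a..b, ζ (r, s) = 0 := by
      intro r
      simp only [ζ]
      have i1 : IntervalIntegrable (fun s => φ (r, s)) volume a b :=
        (hφ.continuous.comp (by fun_prop)).intervalIntegrable _ _
      have i2 : IntervalIntegrable (fun s => η s * Φ r) volume a b :=
        (hηc.continuous.mul continuous_const).intervalIntegrable _ _
      rw [intervalIntegral.integral_sub i1 i2, intervalIntegral.integral_mul_const, hηab, one_mul, sub_self]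
    have hZ0 : ∀ p, p ∉ Icc r1 r2 ×ˢ Icc a b → Z p = 0 := by
      rintro ⟨r, θ⟩ hp
      by_cases hr : r ∈ Icc r1 r2
      · have hθ : θ ∉ Icc a b := fun h => hp ⟨hr, h⟩
        rcases lt_or_ge θ a with h | h
        · simp only [Z]
          rw [intervalIntegral.integral_of_ge h.le, integral_Ioc_eq_integral_Ioo,
            setIntegral_eq_zero_of_forall_eq_zero, neg_zero]
          exact fun s hs => hζ0 r s fun hs' => absurd hs.2 (not_lt.2 hs'.1)
        · have hbθ : b < θ := not_le.1 fun h' => hθ ⟨h, h'⟩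
          simp only [Z]
          rw [← intervalIntegral.integral_add_adjacent_intervals
            ((hζc r).intervalIntegrable a b) ((hζc r).intervalIntegrable b θ), hZb, zero_add,
            intervalIntegral.integral_of_le hbθ.le, setIntegral_eq_zero_of_forall_eq_zero]
          exact fun s hs => hζ0 r s fun hs' => absurd hs.1 (not_lt.2 hs'.2)
      · simp only [Z, hζ1 r _ hr, intervalIntegral.integral_zero]
    have hbox : IsCompact (Icc r1 r2 ×ˢ Icc a b) := isCompact_Icc.prod isCompact_Icc
    have hZs : tsupport Z ⊆ Icc r1 r2 ×ˢ Icc a b :=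
      closure_minimal (fun p hp => by_contra fun h => hp (hZ0 p h)) hbox.isClosed
    have h1 := hd.2.2 Z (contDiff_integral_of_support hζ hζ0)
      (HasCompactSupport.intro hbox fun p hp => hZ0 p hp)
      (hZs.trans (prod_mono (fun x hx => ⟨hr1.trans_le hx.1, hx.2.trans_lt hr2⟩)
        fun x hx => ⟨ha0.trans_le hx.1, hx.2.trans_lt hbΘ⟩))
    simp only [Z, fderiv_integral_dirTheta hζ hζ0, Pi.zero_apply, zero_mul, integral_zero,
      neg_zero] at h1
    have hζs : tsupport ζ ⊆ Icc r1 r2 ×ˢ Icc a b :=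
      closure_minimal (fun p hp => by_contra fun h => hp (by
        obtain ⟨r, θ⟩ := p
        by_cases hr : r ∈ Icc r1 r2
        · exact hζ0 r θ fun hθ => h ⟨hr, hθ⟩
        · exact hζ1 r θ hr)) hbox.isClosed
    have hi1 : IntegrableOn (fun p => f p * ζ p) (Q Θ) :=
      (integrable_mul_of_tsupport_subset hf.wr_locallyIntegrableOn hζ.continuous
        (hbox.of_isClosed_subset (isClosed_tsupport _) hζs)
        (hζs.trans (prod_mono (fun x hx => ⟨hr1.trans_le hx.1, hx.2.trans_lt hr2⟩)
        fun x hx => ⟨ha0.trans_le hx.1, hx.2.trans_lt hbΘ⟩))).integrableOn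
    have hi2 : IntegrableOn (fun p => (f - fun p : ℝ × ℝ => c p.1) p * φ p) (Q Θ) :=
      (integrable_mul_of_tsupport_subset hloc hφ.continuous hc hs).integrableOn
    have h2 : ∫ p in Q Θ, (f - fun p : ℝ × ℝ => c p.1) p * φ p = ∫ p in Q Θ, f p * ζ p := by
      rw [IntegrableOn, volume_restrict_Q] at hi1 hi2
      rw [volume_restrict_Q, integral_prod _ hi1, integral_prod _ hi2]
      refine integral_congr_ae ?_
      filter_upwards [hf.ae_memLp_slice] with r hr
      simp only [← restrict_Ioc_eq, Pi.sub_apply, ζ]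
      have hφr : Continuous fun s => φ (r, s) := hφ.continuous.comp (by fun_prop)
      have hφL : MemLp (fun s => φ (r, s)) 2 (volume.restrict (Ioc 0 Θ)) :=
        (hφr.memLp_of_hasCompactSupport
          (HasCompactSupport.intro isCompact_Icc fun s hs => hφ2 r s hs)).restrict _
      have j1 : Integrable (fun s => f (r, s) * φ (r, s)) (volume.restrict (Ioc 0 Θ)) :=
        hr.integrable_mul hφL
      have j2 : Integrable (fun s => f (r, s) * η s) (volume.restrict (Ioc 0 Θ)) :=
        hr.integrable_mul hηm
      have j3 : ∫ s in Ioc 0 Θ, φ (r, s) = Φ r := by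
        simp only [Φ]
        rw [intervalIntegral.integral_of_le hab, ← integral_Icc_eq_integral_Ioc (x := a)]
        exact setIntegral_eq_of_subset_of_forall_sdiff_eq_zero measurableSet_Ioc
          (fun x hx => ⟨ha0.trans_le hx.1, hx.2.trans hbΘ.le⟩) fun s hs => hφ2 r s hs.2
      have e1 : ∀ s, f (r, s) * (φ (r, s) - η s * Φ r)
          = f (r, s) * φ (r, s) - (f (r, s) * η s) * Φ r := fun s => by ring
      simp only [e1, sub_mul]
      rw [integral_sub j1 ((hφL.integrable (by norm_num)).const_mul _),
        integral_sub j1 (j2.mul_const _), integral_const_mul, integral_mul_const, j3]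
    rw [← h2, setIntegral_eq_integral_of_forall_compl_eq_zero] at h1
    · simpa [mul_comm] using h1
    · intro x hx
      rw [image_eq_zero_of_notMem_tsupport fun hx' => hx (hs hx'), mul_zero]
  filter_upwards [(ae_restrict_iff' (measurableSet_Q Θ)).2 hmain] with p hp
  exact sub_eq_zero.1 hp

/-- A function with a weak angular derivative is the primitive of that derivative, up to a function
of the radius. -/
theorem IsWeakDeriv.exists_eq_primitive {Θ : ℝ} (hΘ : 0 < Θ) {v g : ℝ × ℝ → ℝ}
    (hvm : StronglyMeasurable v) (hgm : StronglyMeasurable g)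
    (hv : MemL2 (Q Θ) wr v) (hg : MemL2 (Q Θ) wr g) (hd : IsWeakDeriv (Q Θ) dirTheta v g) :
    ∃ c : ℝ → ℝ, StronglyMeasurable c ∧
      ∀ᵐ p ∂volume.restrict (Q Θ), v p = c p.1 + angularPrimitive g p := by
  have hB := memL2_angularPrimitive hΘ hgm hg
  have hBd : IsWeakDeriv (Q Θ) dirTheta (angularPrimitive g) g :=
    isWeakDeriv_of_ae_primitive (c := 0) hΘ hB hg (by simp)
  have h0 := hd.sub hBd
  rw [sub_self] at h0
  obtain ⟨c, hcm, hc⟩ := h0.exists_radial hΘ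
    (hvm.sub (stronglyMeasurable_angularPrimitive hgm))
    (hv.sub (measurableSet_Q Θ) aestronglyMeasurable_wr wr_nonneg hB)
  refine ⟨c, hcm, hc.mono fun p hp => ?_⟩
  rw [← hp, Pi.sub_apply, sub_add_cancel]

/-! ### Norms -/

theorem normH1_sq (Θ : ℝ) (v : ℝ × ℝ → ℝ) : normH1 Θ v ^ 2 = normL2 (Q Θ) wr v ^ 2
    + normL2 (Q Θ) wr (dR Θ v) ^ 2 + normL2 (Q Θ) wrInv (dTheta Θ v) ^ 2 :=
  Real.sq_sqrt (by positivity)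

theorem normU_sq (Θ : ℝ) (v : ℝ × ℝ → ℝ) : normU Θ v ^ 2 = normL2 (Q Θ) wr v ^ 2
    + normL2 (Q Θ) wr (dR Θ v) ^ 2 + normL2 (Q Θ) wrInv (dTheta Θ v) ^ 2
    + normL2 (Q Θ) wr (dRTheta Θ v) ^ 2 := by
  rw [← normH1_sq]
  exact Real.sq_sqrt (by positivity)

theorem normH1r_sq (g : ℝ → ℝ) : normH1r g ^ 2 = normL2 (Ioo 0 1) (fun r => r) g ^ 2
    + normL2 (Ioo 0 1) (fun r => r) (weakDeriv (Ioo 0 1) (1 : ℝ) g) ^ 2 :=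
  Real.sq_sqrt (by positivity)

theorem normL2_wr_sq (Θ : ℝ) (v : ℝ × ℝ → ℝ) :
    normL2 (Q Θ) wr v ^ 2 = ∫ p in Q Θ, v p ^ 2 * wr p :=
  normL2_sq (measurableSet_Q Θ) wr_nonneg

theorem normL2_wrInv_sq (Θ : ℝ) (v : ℝ × ℝ → ℝ) :
    normL2 (Q Θ) wrInv v ^ 2 = ∫ p in Q Θ, v p ^ 2 * wrInv p :=
  normL2_sq (measurableSet_Q Θ) wrInv_nonneg

theorem radial_nonneg : ∀ r ∈ Ioo (0 : ℝ) 1, 0 ≤ r := fun _ hr => hr.1.le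

theorem normL2_radial_sq (g : ℝ → ℝ) :
    normL2 (Ioo 0 1) (fun r => r) g ^ 2 = ∫ r in Ioo (0 : ℝ) 1, g r ^ 2 * r :=
  normL2_sq measurableSet_Ioo radial_nonneg

theorem normL2_wr_le_normL2_wrInv {Θ : ℝ} {v : ℝ × ℝ → ℝ} (hv : MemL2 (Q Θ) wrInv v) :
    ∫ p in Q Θ, v p ^ 2 * wr p ≤ ∫ p in Q Θ, v p ^ 2 * wrInv p :=
  setIntegral_mono_on hv.wr_of_wrInv.2 hv.2 (measurableSet_Q Θ) fun p hp =>
    mul_le_mul_of_nonneg_left (wr_le_wrInv p hp) (sq_nonneg _)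

/-! ### Smooth functions -/

theorem contDiff_fderiv_apply {φ : ℝ × ℝ → ℝ} (hφ : ContDiff ℝ ∞ φ) (e : ℝ × ℝ) :
    ContDiff ℝ ∞ fun p => fderiv ℝ φ p e :=
  (hφ.fderiv_right (m := ∞) (by simp)).clm_apply contDiff_const

theorem memL2_wr_of_continuous {Θ : ℝ} {φ : ℝ × ℝ → ℝ} (hφ : Continuous φ) :
    MemL2 (Q Θ) wr φ := by
  refine ⟨hφ.aestronglyMeasurable, ?_⟩
  have h : IntegrableOn (fun p => φ p ^ 2 * wr p) (Icc (0 : ℝ) 1 ×ˢ Icc 0 Θ) :=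
    ((hφ.pow 2).mul continuous_wr).continuousOn.integrableOn_compact
      (isCompact_Icc.prod isCompact_Icc)
  exact h.mono_set (prod_mono Ioo_subset_Icc_self Ioo_subset_Icc_self)

theorem memL2_radial_of_continuous {φ : ℝ → ℝ} (hφ : Continuous φ) :
    MemL2 (Ioo 0 1) (fun r => r) φ := by
  refine ⟨hφ.aestronglyMeasurable, ?_⟩
  have h : IntegrableOn (fun p => φ p ^ 2 * p) (Icc (0 : ℝ) 1) :=
    ((hφ.pow 2).mul continuous_id).continuousOn.integrableOn_compact isCompact_Icc
  exact h.mono_set Ioo_subset_Icc_self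

theorem isWeakDeriv_restriction {φ : ℝ × ℝ → ℝ} (hφ : ContDiff ℝ ∞ φ) (ϑ : ℝ) :
    IsWeakDeriv (Ioo 0 1) (1 : ℝ) (fun r => φ (r, ϑ)) (fun r => fderiv ℝ φ (r, ϑ) dirR) := by
  have h1 : ContDiff ℝ ∞ fun r => φ (r, ϑ) := hφ.comp (contDiff_id.prodMk contDiff_const)
  convert isWeakDeriv_of_contDiff (Ω := Ioo 0 1) (e := (1 : ℝ)) h1 using 2 with r
  rw [fderiv_apply_one_eq_deriv, (fderiv_apply_dirR hφ r ϑ).deriv]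

theorem eq_add_integral_fderiv {φ : ℝ × ℝ → ℝ} (hφ : ContDiff ℝ ∞ φ) (r ϑ θ : ℝ) :
    φ (r, θ) = φ (r, ϑ) + ∫ t in ϑ..θ, fderiv ℝ φ (r, t) dirTheta := by
  rw [intervalIntegral.integral_eq_sub_of_hasDerivAt
    (fun t _ => fderiv_apply_dirTheta hφ r t)]
  · ring
  · exact ((continuous_fderiv_apply_const hφ _).comp (by fun_prop)).intervalIntegrable _ _

/-! ### Traces on radial segments -/

/-- The trace inequality for functions given as angular primitives. -/
theorem trace_estimate {Θ ϑ : ℝ} (hΘ : 0 < Θ) (hϑ : ϑ ∈ Icc 0 Θ) {v g : ℝ × ℝ → ℝ} {γ : ℝ → ℝ}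
    (hγ : AEStronglyMeasurable γ (volume.restrict (Ioo 0 1)))
    (hv : MemL2 (Q Θ) wr v) (hg : MemL2 (Q Θ) wr g)
    (h : ∀ᵐ r ∂volume.restrict (Ioo (0 : ℝ) 1), ∀ᵐ θ ∂volume.restrict (Ioc 0 Θ),
      v (r, θ) = γ r + ∫ t in ϑ..θ, g (r, t)) :
    MemL2 (Ioo 0 1) (fun r => r) γ ∧ ∫ r in Ioo (0 : ℝ) 1, γ r ^ 2 * r
      ≤ 2 / Θ * (∫ p in Q Θ, v p ^ 2 * wr p) + 2 * Θ * ∫ p in Q Θ, g p ^ 2 * wr p := by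
  have hv2 := hv.2
  have hg2 := hg.2
  rw [IntegrableOn, volume_restrict_Q] at hv2 hg2
  have hF := (hv2.integral_prod_left.const_mul (2 / Θ)).add
    (hg2.integral_prod_left.const_mul (2 * Θ))
  have hle : ∀ᵐ r ∂volume.restrict (Ioo (0 : ℝ) 1), γ r ^ 2 * r
      ≤ 2 / Θ * (∫ θ in Ioo 0 Θ, v (r, θ) ^ 2 * wr (r, θ))
        + 2 * Θ * ∫ θ in Ioo 0 Θ, g (r, θ) ^ 2 * wr (r, θ) := by
    filter_upwards [h, hv.ae_memLp_slice, hg.ae_memLp_slice, ae_restrict_mem measurableSet_Ioo]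
      with r hr hvr hgr hr0
    simp only [wr, integral_mul_const, ← restrict_Ioc_eq]
    set G := ∫ t in Ioc 0 Θ, g (r, t) ^ 2
    -- Since `γ = v - ∫_ϑ^θ g` for almost every `θ`, this bound can be averaged over `(0, Θ)`;
    -- dividing by `Θ` produces the factors `2/Θ` and `2Θ`.
    have h1 : ∀ᵐ θ ∂volume.restrict (Ioc 0 Θ), γ r ^ 2 ≤ 2 * v (r, θ) ^ 2 + 2 * (Θ * G) := by
      filter_upwards [hr, ae_restrict_mem measurableSet_Ioc] with θ hθ hθm
      have h2 := sq_intervalIntegral_le hgr hϑ (b := θ) ⟨hθm.1.le, hθm.2⟩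
      rw [sub_zero] at h2
      have h3 : γ r = v (r, θ) - ∫ t in ϑ..θ, g (r, t) := by rw [hθ]; ring
      rw [h3]
      nlinarith [sq_nonneg (v (r, θ) + ∫ t in ϑ..θ, g (r, t))]
    have h4 := integral_mono_ae (integrable_const (γ r ^ 2))
      ((hvr.integrable_sq.const_mul 2).add (integrable_const (2 * (Θ * G)))) h1
    simp only [Pi.add_apply] at h4
    rw [integral_add (hvr.integrable_sq.const_mul 2) (integrable_const _),
      integral_const_mul] at h4
    simp only [integral_const, MeasurableSet.univ, measureReal_restrict_apply, univ_inter,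
      Real.volume_real_Ioc_of_le hΘ.le, smul_eq_mul, sub_zero] at h4
    have h5 : γ r ^ 2 ≤ 2 / Θ * (∫ θ in Ioc 0 Θ, v (r, θ) ^ 2) + 2 * Θ * G := by
      rw [← mul_le_mul_iff_right₀ hΘ]
      refine h4.trans (le_of_eq ?_)
      field_simp
    calc γ r ^ 2 * r ≤ _ * r := mul_le_mul_of_nonneg_right h5 hr0.1.le
      _ = _ := by ring
  have hM : MemL2 (Ioo 0 1) (fun r => r) γ :=
    MemL2.of_le measurableSet_Ioo hγ measurable_id.aestronglyMeasurable radial_nonneg hF hle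
  refine ⟨hM, (integral_mono_ae hM.2 hF hle).trans (le_of_eq ?_)⟩
  simp only [Pi.add_apply]
  rw [integral_add (hv2.integral_prod_left.const_mul (2 / Θ))
    (hg2.integral_prod_left.const_mul (2 * Θ)), integral_const_mul, integral_const_mul,
    volume_restrict_Q, integral_prod _ hv2, integral_prod _ hg2]

/-- `u` and `∂_r u` as angular primitives of `b = ∂_θ u` and `d = ∂_{rθ} u`. -/
structure AngularExpansion (Θ : ℝ) (u b d : ℝ × ℝ → ℝ) (k k' : ℝ → ℝ) : Prop where
  b_meas : StronglyMeasurable b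
  d_meas : StronglyMeasurable d
  k_meas : StronglyMeasurable k
  k'_meas : StronglyMeasurable k'
  b_mem : MemL2 (Q Θ) wrInv b
  d_mem : MemL2 (Q Θ) wr d
  b_ae : dTheta Θ u =ᵐ[volume.restrict (Q Θ)] b
  d_ae : dRTheta Θ u =ᵐ[volume.restrict (Q Θ)] d
  u_eq : ∀ᵐ p ∂volume.restrict (Q Θ), u p = k p.1 + angularPrimitive b p
  dR_eq : ∀ᵐ p ∂volume.restrict (Q Θ), dR Θ u p = k' p.1 + angularPrimitive d p

/-- Passing to strongly measurable representatives makes the slices and primitives measurable, so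
that the structure result applies to classes known only almost everywhere. -/
theorem exists_eq_primitive_of_isWeakDeriv {Θ : ℝ} (hΘ : 0 < Θ) {v g : ℝ × ℝ → ℝ}
    (hv : MemL2 (Q Θ) wr v) (hg : MemL2 (Q Θ) wr g) (hd : IsWeakDeriv (Q Θ) dirTheta v g) :
    ∃ (g₀ : ℝ × ℝ → ℝ) (c : ℝ → ℝ), StronglyMeasurable g₀ ∧ StronglyMeasurable c ∧
      g =ᵐ[volume.restrict (Q Θ)] g₀ ∧
      ∀ᵐ p ∂volume.restrict (Q Θ), v p = c p.1 + angularPrimitive g₀ p := by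
  obtain ⟨v₀, hv₀, hv₀'⟩ := hv.1
  obtain ⟨g₀, hg₀, hg₀'⟩ := hg.1
  obtain ⟨c, hc, hc'⟩ := (hd.congr hv₀' hg₀').exists_eq_primitive hΘ hv₀ hg₀ (hv.congr hv₀')
    (hg.congr hg₀')
  refine ⟨g₀, c, hg₀, hc, hg₀', ?_⟩
  filter_upwards [hc', hv₀'] with p h1 h2
  rw [h2, h1]

theorem MemU.exists_angularExpansion {Θ : ℝ} (hΘ : 0 < Θ) {u : ℝ × ℝ → ℝ} (hu : MemU Θ u) :
    ∃ b d k k', AngularExpansion Θ u b d k k' := by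
  obtain ⟨⟨hu0, ⟨-, hc⟩, hbW, hb⟩, ⟨hdW, hd⟩, -⟩ := hu
  obtain ⟨b, k, hbm, hkm, hb', hk⟩ := exists_eq_primitive_of_isWeakDeriv hΘ hu0 hb.wr_of_wrInv
    (IsWeakDeriv.isWeakDeriv_weakDeriv hbW)
  obtain ⟨d, k', hdm, hkm', hd', hk'⟩ := exists_eq_primitive_of_isWeakDeriv hΘ hc hd
    (IsWeakDeriv.isWeakDeriv_weakDeriv hdW)
  exact ⟨b, d, k, k', hbm, hdm, hkm, hkm', hb.congr hb', hd.congr hd', hb', hd', hk, hk'⟩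

theorem ae_eq_add_integral {Θ ϑ : ℝ} (hΘ : 0 < Θ) (hϑ : ϑ ∈ Icc 0 Θ) {v g : ℝ × ℝ → ℝ}
    {k : ℝ → ℝ} (hg : MemL2 (Q Θ) wr g)
    (h : ∀ᵐ p ∂volume.restrict (Q Θ), v p = k p.1 + angularPrimitive g p) :
    ∀ᵐ r ∂volume.restrict (Ioo (0 : ℝ) 1), ∀ᵐ θ ∂volume.restrict (Ioc 0 Θ),
      v (r, θ) = (k r + angularPrimitive g (r, ϑ)) + ∫ t in ϑ..θ, g (r, t) := by
  filter_upwards [ae_Q_iff_slices h, hg.ae_memLp_slice] with r hr hgr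
  filter_upwards [hr, ae_restrict_mem measurableSet_Ioc] with θ hθ hθm
  have h0 : (0 : ℝ) ∈ Icc 0 Θ := ⟨le_rfl, hΘ.le⟩
  rw [hθ, add_assoc]
  simp only [angularPrimitive]
  rw [intervalIntegral.integral_add_adjacent_intervals
    (intervalIntegrable_of_memLp hgr hΘ.le h0 hϑ)
    (intervalIntegrable_of_memLp hgr hΘ.le hϑ ⟨hθm.1.le, hθm.2⟩)]

/-- Convergence of traces of smooth functions. -/
theorem tendsto_trace {Θ ϑ : ℝ} (hΘ : 0 < Θ) (hϑ : ϑ ∈ Icc 0 Θ) {v g : ℝ × ℝ → ℝ}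
    {k : ℝ → ℝ} (hk : StronglyMeasurable k) (hgm : StronglyMeasurable g)
    (hv : MemL2 (Q Θ) wr v) (hg : MemL2 (Q Θ) wr g)
    (h : ∀ᵐ p ∂volume.restrict (Q Θ), v p = k p.1 + angularPrimitive g p)
    {φ : ℕ → ℝ × ℝ → ℝ} (hφ : ∀ j, ContDiff ℝ ∞ (φ j))
    (hlim : Tendsto (fun j => ∫ p in Q Θ, (φ j p - v p) ^ 2 * wr p) atTop (𝓝 0))
    (hlim' : Tendsto (fun j => ∫ p in Q Θ, (fderiv ℝ (φ j) p dirTheta - g p) ^ 2 * wr p)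
      atTop (𝓝 0)) :
    Tendsto (fun j => ∫ r in Ioo (0 : ℝ) 1,
      (φ j (r, ϑ) - (k r + angularPrimitive g (r, ϑ))) ^ 2 * r) atTop (𝓝 0) := by
  have hγm : StronglyMeasurable fun r => k r + angularPrimitive g (r, ϑ) :=
    hk.add ((stronglyMeasurable_angularPrimitive hgm).comp_measurable measurable_prodMk_right)
  have hbd : ∀ j, ∫ r in Ioo (0 : ℝ) 1, (φ j (r, ϑ) - (k r + angularPrimitive g (r, ϑ))) ^ 2 * r
      ≤ 2 / Θ * (∫ p in Q Θ, (φ j p - v p) ^ 2 * wr p)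
        + 2 * Θ * ∫ p in Q Θ, (fderiv ℝ (φ j) p dirTheta - g p) ^ 2 * wr p := by
    intro j
    have hc := continuous_fderiv_apply_const (hφ j) dirTheta
    refine (trace_estimate hΘ hϑ (v := φ j - v)
      (g := (fun p => fderiv ℝ (φ j) p dirTheta) - g)
      (γ := fun r => φ j (r, ϑ) - (k r + angularPrimitive g (r, ϑ))) ?_ ?_ ?_ ?_).2
    · exact (((hφ j).continuous.comp (by fun_prop)).stronglyMeasurable.sub
        hγm).aestronglyMeasurable
    · exact (memL2_wr_of_continuous (hφ j).continuous).sub (measurableSet_Q Θ)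
        aestronglyMeasurable_wr wr_nonneg hv
    · exact (memL2_wr_of_continuous hc).sub (measurableSet_Q Θ)
        aestronglyMeasurable_wr wr_nonneg hg
    · filter_upwards [ae_eq_add_integral hΘ hϑ hg h, hg.ae_memLp_slice] with r hr hgr
      filter_upwards [hr, ae_restrict_mem measurableSet_Ioc] with θ hθ hθm
      simp only [Pi.sub_apply]
      have i1 : IntervalIntegrable (fun t => fderiv ℝ (φ j) (r, t) dirTheta) volume ϑ θ :=
        (hc.comp (by fun_prop)).intervalIntegrable _ _
      have i2 := intervalIntegrable_of_memLp hgr hΘ.le hϑ (b := θ) ⟨hθm.1.le, hθm.2⟩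
      rw [hθ, intervalIntegral.integral_sub i1 i2, eq_add_integral_fderiv (hφ j) r ϑ θ]
      ring
  refine squeeze_zero (fun j => ?_) hbd ?_
  · exact setIntegral_nonneg measurableSet_Ioo fun r hr => mul_nonneg (sq_nonneg _) hr.1.le
  · simpa using (hlim.const_mul (2 / Θ)).add (hlim'.const_mul (2 * Θ))

/-- Convergence in the norm of `U` in terms of the classical derivatives. -/
theorem SmoothH1.le_normU {Θ : ℝ} {u b d φ : ℝ × ℝ → ℝ} {k k' : ℝ → ℝ} (hu : MemU Θ u)
    (hX : AngularExpansion Θ u b d k k') (hφ : SmoothH1 Θ φ) :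
    ∫ p in Q Θ, (φ p - u p) ^ 2 * wr p ≤ normU Θ (φ - u) ^ 2 ∧
    ∫ p in Q Θ, (fderiv ℝ φ p dirR - dR Θ u p) ^ 2 * wr p ≤ normU Θ (φ - u) ^ 2 ∧
    ∫ p in Q Θ, (fderiv ℝ φ p dirTheta - b p) ^ 2 * wr p ≤ normU Θ (φ - u) ^ 2 ∧
    ∫ p in Q Θ, (fderiv ℝ (fun q => fderiv ℝ φ q dirR) p dirTheta - d p) ^ 2 * wr p
      ≤ normU Θ (φ - u) ^ 2 := by
  have hΩ := isOpen_Q Θ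
  obtain ⟨⟨hu0, ⟨hcW, hc⟩, hbW, hb⟩, ⟨hdW, hd⟩, -⟩ := hu
  have w1 : IsWeakDeriv (Q Θ) dirR (φ - u) ((fun p => fderiv ℝ φ p dirR) - dR Θ u) :=
    (isWeakDeriv_of_contDiff hφ.1).sub (IsWeakDeriv.isWeakDeriv_weakDeriv hcW)
  have w2 : IsWeakDeriv (Q Θ) dirTheta (φ - u) ((fun p => fderiv ℝ φ p dirTheta) - b) :=
    (isWeakDeriv_of_contDiff hφ.1).sub
      ((IsWeakDeriv.isWeakDeriv_weakDeriv hbW).congr (EventuallyEq.refl _ _) hX.b_ae)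
  have a1 : dR Θ (φ - u) =ᵐ[volume.restrict (Q Θ)] _ := w1.weakDeriv_ae_eq hΩ
  have a2 : dTheta Θ (φ - u) =ᵐ[volume.restrict (Q Θ)] _ := w2.weakDeriv_ae_eq hΩ
  have w3 : IsWeakDeriv (Q Θ) dirTheta (dR Θ (φ - u))
      ((fun p => fderiv ℝ (fun q => fderiv ℝ φ q dirR) p dirTheta) - d) :=
    ((isWeakDeriv_of_contDiff (contDiff_fderiv_apply hφ.1 dirR)).sub
      ((IsWeakDeriv.isWeakDeriv_weakDeriv hdW).congr (EventuallyEq.refl _ _) hX.d_ae)).congr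
      a1.symm (EventuallyEq.refl _ _)
  have a3 : dRTheta Θ (φ - u) =ᵐ[volume.restrict (Q Θ)] _ := w3.weakDeriv_ae_eq hΩ
  have e := normU_sq Θ (φ - u)
  rw [normL2_congr a1, normL2_congr a2, normL2_congr a3] at e
  -- Smoothness up to the boundary does not give integrability against `1/r` near `r = 0`; it comes
  -- from membership in `H̃¹(Q)`.
  have hφθ : MemL2 (Q Θ) wrInv fun p => fderiv ℝ φ p dirTheta :=
    hφ.2.2.2.2.congr ((isWeakDeriv_of_contDiff hφ.1).weakDeriv_ae_eq hΩ)
  have hle := normL2_wr_le_normL2_wrInv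
    (hφθ.sub (measurableSet_Q Θ) aestronglyMeasurable_wrInv wrInv_nonneg hX.b_mem)
  have n1 := sq_nonneg (normL2 (Q Θ) wr (φ - u))
  have n2 := sq_nonneg (normL2 (Q Θ) wr ((fun p => fderiv ℝ φ p dirR) - dR Θ u))
  have n3 := sq_nonneg (normL2 (Q Θ) wrInv ((fun p => fderiv ℝ φ p dirTheta) - b))
  have n4 := sq_nonneg (normL2 (Q Θ) wr
    ((fun p => fderiv ℝ (fun q => fderiv ℝ φ q dirR) p dirTheta) - d))
  rw [← normL2_wrInv_sq] at hle
  rw [normL2_wr_sq] at n1 n2 n4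
  rw [normL2_wr_sq, normL2_wr_sq, normL2_wr_sq] at e
  simp only [Pi.sub_apply] at *
  refine ⟨?_, ?_, ?_, ?_⟩ <;> linarith

theorem tendsto_zero_of_le_sq {f g : ℕ → ℝ} (hf : ∀ j, 0 ≤ f j) (hfg : ∀ j, f j ≤ g j ^ 2)
    (hg : Tendsto g atTop (𝓝 0)) : Tendsto f atTop (𝓝 0) :=
  squeeze_zero hf hfg (by simpa using hg.pow 2)

section Trace

variable {Θ ϑ : ℝ} {u b d : ℝ × ℝ → ℝ} {k k' : ℝ → ℝ}

/-- The trace convergence is used for the pair `(u, b)` and again for `(∂_r u, d)`. The second use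
is why the `U`-norm contains the mixed derivative. -/
theorem AngularExpansion.tendsto_trace (hΘ : 0 < Θ) (hϑ : ϑ ∈ Icc 0 Θ) (hu : MemU Θ u)
    (hX : AngularExpansion Θ u b d k k') {φ : ℕ → ℝ × ℝ → ℝ} (hφ : ∀ j, SmoothH1 Θ (φ j))
    (hlim : Tendsto (fun j => normU Θ (φ j - u)) atTop (𝓝 0)) :
    Tendsto (fun j => ∫ r in Ioo (0 : ℝ) 1,
      (φ j (r, ϑ) - (k r + angularPrimitive b (r, ϑ))) ^ 2 * r) atTop (𝓝 0) ∧
    Tendsto (fun j => ∫ r in Ioo (0 : ℝ) 1,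
      (fderiv ℝ (φ j) (r, ϑ) dirR - (k' r + angularPrimitive d (r, ϑ))) ^ 2 * r)
      atTop (𝓝 0) := by
  have hle := fun j => SmoothH1.le_normU hu hX (hφ j)
  have hnn : ∀ f : ℝ × ℝ → ℝ, 0 ≤ ∫ p in Q Θ, f p ^ 2 * wr p := fun f =>
    setIntegral_nonneg (measurableSet_Q Θ) fun p hp => mul_nonneg (sq_nonneg _) (wr_nonneg p hp)
  have l1 := tendsto_zero_of_le_sq (fun j => hnn _) (fun j => (hle j).1) hlim
  have l2 := tendsto_zero_of_le_sq (fun j => hnn _) (fun j => (hle j).2.1) hlim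
  have l3 := tendsto_zero_of_le_sq (fun j => hnn _) (fun j => (hle j).2.2.1) hlim
  have l4 := tendsto_zero_of_le_sq (fun j => hnn _) (fun j => (hle j).2.2.2) hlim
  exact ⟨SBFEM.tendsto_trace hΘ hϑ hX.k_meas hX.b_meas hu.1.1 hX.b_mem.wr_of_wrInv hX.u_eq
      (fun j => (hφ j).1) l1 l3,
    SBFEM.tendsto_trace (φ := fun j p => fderiv ℝ (φ j) p dirR) hΘ hϑ hX.k'_meas hX.d_meas
      hu.1.2.1.2 hX.d_mem hX.dR_eq (fun j => contDiff_fderiv_apply (hφ j).1 dirR) l2 l4⟩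

theorem AngularExpansion.memL2_trace (hΘ : 0 < Θ) (hϑ : ϑ ∈ Icc 0 Θ) (hu : MemU Θ u)
    (hX : AngularExpansion Θ u b d k k') :
    MemL2 (Ioo 0 1) (fun r => r) (fun r => k r + angularPrimitive b (r, ϑ)) ∧
    MemL2 (Ioo 0 1) (fun r => r) (fun r => k' r + angularPrimitive d (r, ϑ)) :=
  ⟨(trace_estimate hΘ hϑ (hX.k_meas.add ((stronglyMeasurable_angularPrimitive
      hX.b_meas).comp_measurable measurable_prodMk_right)).aestronglyMeasurable hu.1.1
      hX.b_mem.wr_of_wrInv (ae_eq_add_integral hΘ hϑ hX.b_mem.wr_of_wrInv hX.u_eq)).1,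
    (trace_estimate hΘ hϑ (hX.k'_meas.add ((stronglyMeasurable_angularPrimitive
      hX.d_meas).comp_measurable measurable_prodMk_right)).aestronglyMeasurable hu.1.2.1.2
      hX.d_mem (ae_eq_add_integral hΘ hϑ hX.d_mem hX.dR_eq)).1⟩

/-- The functions `k` and `k'` come from unrelated expansions; the density of smooth functions links
them. The relation is classical for restrictions of smooth functions and survives the weighted
limit. -/
theorem AngularExpansion.isWeakDeriv_trace (hΘ : 0 < Θ) (hϑ : ϑ ∈ Icc 0 Θ) (hu : MemU Θ u)
    (hX : AngularExpansion Θ u b d k k') :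
    IsWeakDeriv (Ioo 0 1) (1 : ℝ) (fun r => k r + angularPrimitive b (r, ϑ))
      (fun r => k' r + angularPrimitive d (r, ϑ)) := by
  obtain ⟨φ, hφ, hlim⟩ := hu.2.2
  obtain ⟨h1, h2⟩ := hX.tendsto_trace hΘ hϑ hu hφ hlim
  obtain ⟨m1, m2⟩ := hX.memL2_trace hΘ hϑ hu
  exact IsWeakDeriv.of_tendsto isOpen_Ioo continuousOn_id (fun r hr => hr.1)
    (fun j => isWeakDeriv_restriction (hφ j).1 ϑ)
    (fun j => memL2_radial_of_continuous ((hφ j).1.continuous.comp (by fun_prop))) m1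
    (fun j => memL2_radial_of_continuous
      ((continuous_fderiv_apply_const (hφ j).1 dirR).comp (by fun_prop))) m2 h1 h2

theorem AngularExpansion.isRadialTrace (hΘ : 0 < Θ) (hϑ : ϑ ∈ Icc 0 Θ) (hu : MemU Θ u)
    (hX : AngularExpansion Θ u b d k k') :
    IsRadialTrace Θ ϑ u fun r => k r + angularPrimitive b (r, ϑ) := by
  have hW := hX.isWeakDeriv_trace hΘ hϑ hu
  obtain ⟨m1, m2⟩ := hX.memL2_trace hΘ hϑ hu
  refine ⟨hu, ⟨m1, ⟨_, hW⟩, m2.congr (hW.weakDeriv_ae_eq isOpen_Ioo).symm⟩, ?_⟩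
  obtain ⟨φ, hφ, hlim⟩ := hu.2.2
  obtain ⟨h1, h2⟩ := hX.tendsto_trace hΘ hϑ hu hφ hlim
  refine ⟨φ, hφ, hlim, ?_⟩
  have h3 := (h1.add h2).sqrt
  rw [add_zero, Real.sqrt_zero] at h3
  refine h3.congr fun j => ?_
  have hWj := (isWeakDeriv_restriction (hφ j).1 ϑ).sub hW
  have e : normL2 (Ioo 0 1) (fun r => r) (weakDeriv (Ioo 0 1) (1 : ℝ)
      (fun r => φ j (r, ϑ) - (k r + angularPrimitive b (r, ϑ)))) = _ :=
    normL2_congr (hWj.weakDeriv_ae_eq isOpen_Ioo)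
  rw [normH1r, e, normL2_radial_sq, normL2_radial_sq]
  rfl

theorem AngularExpansion.isRadialTrace_radialTrace (hΘ : 0 < Θ) (hϑ : ϑ ∈ Icc 0 Θ)
    (hu : MemU Θ u) (hX : AngularExpansion Θ u b d k k') :
    IsRadialTrace Θ ϑ u (radialTrace Θ ϑ u) := by
  have h : ∃ g, IsRadialTrace Θ ϑ u g := ⟨_, hX.isRadialTrace hΘ hϑ hu⟩
  rw [radialTrace, dif_pos h]
  exact h.choose_spec

/-- The chosen trace comes with its own approximating sequence, but restrictions along every
sequence converging in the `U`-norm tend to the explicit trace, so the two limits agree. -/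
theorem AngularExpansion.radialTrace_ae_eq (hΘ : 0 < Θ) (hϑ : ϑ ∈ Icc 0 Θ)
    (hu : MemU Θ u) (hX : AngularExpansion Θ u b d k k') :
    radialTrace Θ ϑ u =ᵐ[volume.restrict (Ioo 0 1)] fun r => k r + angularPrimitive b (r, ϑ) := by
  obtain ⟨-, hg, φ, hφ, hlim, hlim'⟩ := hX.isRadialTrace_radialTrace hΘ hϑ hu
  obtain ⟨h1, -⟩ := hX.tendsto_trace hΘ hϑ hu hφ hlim
  refine ae_eq_of_tendsto measurableSet_Ioo (fun r hr => hr.1)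
    measurable_id.aestronglyMeasurable
    (fun j => memL2_radial_of_continuous ((hφ j).1.continuous.comp (by fun_prop)))
    hg.1 (hX.memL2_trace hΘ hϑ hu).1 ?_ h1
  refine tendsto_zero_of_le_sq (fun j => ?_) (fun j => ?_) hlim'
  · exact setIntegral_nonneg measurableSet_Ioo fun r hr => mul_nonneg (sq_nonneg _) hr.1.le
  · rw [normH1r_sq, ← normL2_radial_sq]
    exact le_add_of_nonneg_right (sq_nonneg _)

end Trace

/-! ### One-dimensional piecewise linear interpolation -/

namespace AngularPartition

variable {Θ : ℝ} (T : AngularPartition Θ)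

theorem node_strictMonoOn : StrictMonoOn T.node (Iic T.n) :=
  strictMonoOn_of_lt_add_one ordConnected_Iic fun i _ _ hi => T.node_lt i (Nat.lt_of_succ_le hi)

theorem node_mono {i j : ℕ} (hij : i ≤ j) (hj : j ≤ T.n) : T.node i ≤ T.node j :=
  T.node_strictMonoOn.monotoneOn (mem_Iic.2 (hij.trans hj)) (mem_Iic.2 hj) hij

theorem node_mem {i : ℕ} (hi : i ≤ T.n) : T.node i ∈ Icc 0 Θ :=
  ⟨T.node_zero.symm.le.trans (T.node_mono (Nat.zero_le i) hi),
    (T.node_mono hi le_rfl).trans T.node_last.le⟩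

theorem width_pos {i : ℕ} (hi : i < T.n) : 0 < T.node (i + 1) - T.node i :=
  sub_pos.2 (T.node_lt i hi)

theorem width_le_meshSize {i : ℕ} (hi : i < T.n) : T.node (i + 1) - T.node i ≤ T.meshSize :=
  le_ciSup (f := fun i : Fin T.n => T.node ((i : ℕ) + 1) - T.node (i : ℕ))
    (finite_range _).bddAbove ⟨i, hi⟩

theorem n_pos (hΘ : 0 < Θ) : 0 < T.n := by
  refine Nat.pos_of_ne_zero fun h => ?_
  have := T.node_last
  rw [h, T.node_zero] at this
  exact hΘ.ne this

theorem meshSize_nonneg : 0 ≤ T.meshSize :=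
  Real.iSup_nonneg fun i => (T.width_pos i.2).le

theorem meshSize_le (hΘ : 0 < Θ) : T.meshSize ≤ Θ := by
  have : Nonempty (Fin T.n) := ⟨⟨0, T.n_pos hΘ⟩⟩
  refine ciSup_le fun i => ?_
  have h1 := (T.node_mem (Nat.succ_le_of_lt i.2)).2
  have h2 := (T.node_mem i.2.le).1
  linarith

/-- The `i`-th element of the partition. -/
def element (i : ℕ) : Set ℝ := Ioc (T.node i) (T.node (i + 1))

theorem element_subset {i : ℕ} (hi : i < T.n) : T.element i ⊆ Ioc 0 Θ :=
  Ioc_subset_Ioc (T.node_mem hi.le).1 (T.node_mem (Nat.succ_le_of_lt hi)).2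

theorem exists_mem_element {θ : ℝ} (hθ : θ ∈ Ioc 0 Θ) : ∃ i < T.n, θ ∈ T.element i := by
  have key : ∀ m ≤ T.n, θ ≤ T.node m → ∃ i < T.n, θ ∈ T.element i := by
    intro m
    induction m with
    | zero =>
      intro _ h
      rw [T.node_zero] at h
      exact absurd h (not_le.2 hθ.1)
    | succ m ih =>
      intro hm h
      by_cases h' : θ ≤ T.node m
      · exact ih (by omega) h'
      · exact ⟨m, by omega, not_le.1 h', h⟩
  exact key T.n le_rfl (by rw [T.node_last]; exact hθ.2)

theorem disjoint_element {i j : ℕ} (hi : i < T.n) (hj : j < T.n) (hij : i ≠ j) {θ : ℝ}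
    (hθ : θ ∈ T.element j) : θ ∉ T.element i := by
  intro h
  rcases lt_or_gt_of_ne hij with h1 | h1
  · exact absurd (h.2.trans (T.node_mono h1 hj.le)) (not_le.2 hθ.1)
  · exact absurd (hθ.2.trans (T.node_mono h1 hi.le)) (not_le.2 h.1)

/-- To the right of its node the rising branch of the hat is at least `1` (and is the constant `1`
when `j = 0`), so the minimum selects the falling branch. -/
theorem hat_left {j : ℕ} (hj : j < T.n) {θ : ℝ} (hθ : θ ∈ T.element j) :
    T.hat j θ = (T.node (j + 1) - θ) / (T.node (j + 1) - T.node j) := by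
  have hw := T.width_pos hj
  have h1 : 0 ≤ (T.node (j + 1) - θ) / (T.node (j + 1) - T.node j) :=
    div_nonneg (sub_nonneg.2 hθ.2) hw.le
  have h2 : (T.node (j + 1) - θ) / (T.node (j + 1) - T.node j) ≤ 1 :=
    (div_le_one hw).2 (by linarith [hθ.1])
  rw [hat, if_neg hj.ne]
  rw [min_eq_right, max_eq_right h1]
  split_ifs with h0
  · exact h2
  · refine h2.trans ((one_le_div ?_).2 (by linarith [hθ.1]))
    have := T.width_pos (i := j - 1) (by omega)
    rwa [Nat.sub_add_cancel (Nat.pos_of_ne_zero h0)] at this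

theorem hat_right {j : ℕ} (hj : j < T.n) {θ : ℝ} (hθ : θ ∈ T.element j) :
    T.hat (j + 1) θ = (θ - T.node j) / (T.node (j + 1) - T.node j) := by
  have hw := T.width_pos hj
  have h1 : 0 ≤ (θ - T.node j) / (T.node (j + 1) - T.node j) :=
    div_nonneg (sub_nonneg.2 hθ.1.le) hw.le
  have h2 : (θ - T.node j) / (T.node (j + 1) - T.node j) ≤ 1 :=
    (div_le_one hw).2 (by linarith [hθ.2])
  rw [hat, if_neg (Nat.succ_ne_zero j), Nat.add_sub_cancel, min_eq_left, max_eq_right h1]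
  split_ifs with h0
  · exact h2
  · exact h2.trans ((one_le_div (T.width_pos (by omega))).2 (by linarith [hθ.2]))

theorem hat_eq_zero {i j : ℕ} (hi : i ≤ T.n) (hj : j < T.n) (h1 : i ≠ j) (h2 : i ≠ j + 1) {θ : ℝ}
    (hθ : θ ∈ T.element j) : T.hat i θ = 0 := by
  rw [hat, max_eq_left]
  rcases lt_or_gt_of_ne h1 with h | h
  · refine (min_le_right _ _).trans ?_
    rw [if_neg (by omega)]
    refine div_nonpos_of_nonpos_of_nonneg ?_ (T.width_pos (by omega)).le
    have := T.node_mono (i := i + 1) (j := j) h hj.le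
    linarith [hθ.1]
  · refine (min_le_left _ _).trans ?_
    rw [if_neg (by omega)]
    have hw := T.width_pos (i := i - 1) (by omega)
    rw [Nat.sub_add_cancel (by omega)] at hw
    refine div_nonpos_of_nonpos_of_nonneg ?_ hw.le
    have := T.node_mono (i := j + 1) (j := i - 1) (by omega) (by omega)
    linarith [hθ.2]

theorem sum_mul_hat {j : ℕ} (hj : j < T.n) {θ : ℝ} (hθ : θ ∈ T.element j) (p : ℕ → ℝ) :
    ∑ i ∈ Finset.range (T.n + 1), p i * T.hat i θ
      = p j + (p (j + 1) - p j) / (T.node (j + 1) - T.node j) * (θ - T.node j) := by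
  rw [Finset.sum_eq_add_of_mem j (j + 1) (Finset.mem_range.2 (by omega))
    (Finset.mem_range.2 (by omega)) (by omega), T.hat_left hj hθ, T.hat_right hj hθ]
  · have := (T.width_pos hj).ne'
    field_simp
    ring
  · intro i hi hne
    rw [T.hat_eq_zero (Nat.lt_succ_iff.1 (Finset.mem_range.1 hi)) hj hne.1 hne.2 hθ, mul_zero]

theorem continuous_hat (i : ℕ) : Continuous (T.hat i) := by
  unfold hat
  refine continuous_const.max (Continuous.min ?_ ?_) <;> split_ifs <;> fun_prop

/-- The mean of `f` over the `i`-th element. -/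
noncomputable def elementMean (f : ℝ → ℝ) (i : ℕ) : ℝ :=
  (∫ t in T.element i, f t) / (T.node (i + 1) - T.node i)

/-- The piecewise constant function of the element means of `f`. -/
noncomputable def meanProj (f : ℝ → ℝ) (t : ℝ) : ℝ :=
  ∑ i ∈ Finset.range T.n, (T.element i).indicator (fun _ => T.elementMean f i) t

theorem meanProj_eq (f : ℝ → ℝ) {j : ℕ} (hj : j < T.n) {θ : ℝ} (hθ : θ ∈ T.element j) :
    T.meanProj f θ = T.elementMean f j := by
  rw [meanProj, Finset.sum_eq_single_of_mem j (Finset.mem_range.2 hj), indicator_of_mem hθ]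
  intro i hi hij
  rw [indicator_of_notMem (T.disjoint_element (Finset.mem_range.1 hi) hj hij hθ)]

theorem memLp_element {f : ℝ → ℝ} (hf : MemLp f 2 (volume.restrict (Ioc 0 Θ))) {i : ℕ}
    (hi : i < T.n) : MemLp f 2 (volume.restrict (T.element i)) :=
  hf.mono_measure (Measure.restrict_mono_set _ (T.element_subset hi))

theorem memLp_meanProj (f : ℝ → ℝ) : MemLp (T.meanProj f) 2 (volume.restrict (Ioc 0 Θ)) := by
  refine memLp_finsetSum _ fun i _ => ?_
  exact (memLp_const _).indicator measurableSet_Ioc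

theorem setIntegral_eq_sum {F : ℝ → ℝ} (hF : IntegrableOn F (Ioc 0 Θ)) :
    ∫ t in Ioc 0 Θ, F t = ∑ i ∈ Finset.range T.n, ∫ t in T.element i, F t := by
  have h : ∀ i < T.n, IntervalIntegrable F volume (T.node i) (T.node (i + 1)) := fun i hi =>
    (intervalIntegrable_iff_integrableOn_Ioc_of_le (T.node_lt i hi).le).2
      (hF.mono_set (T.element_subset hi))
  have h1 := intervalIntegral.sum_integral_adjacent_intervals h
  rw [T.node_zero, T.node_last, intervalIntegral.integral_of_le
    (T.node_last ▸ (T.node_mem le_rfl).1)] at h1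
  rw [← h1]
  refine Finset.sum_congr rfl fun i hi => ?_
  rw [intervalIntegral.integral_of_le (T.node_lt i (Finset.mem_range.1 hi)).le, element]

theorem setIntegral_le_of_element {F G : ℝ → ℝ} {K : ℝ} (hF : IntegrableOn F (Ioc 0 Θ))
    (hG : IntegrableOn G (Ioc 0 Θ))
    (h : ∀ i < T.n, ∫ t in T.element i, F t ≤ K * ∫ t in T.element i, G t) :
    ∫ t in Ioc 0 Θ, F t ≤ K * ∫ t in Ioc 0 Θ, G t := by
  rw [T.setIntegral_eq_sum hF, T.setIntegral_eq_sum hG, Finset.mul_sum]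
  exact Finset.sum_le_sum fun i hi => h i (Finset.mem_range.1 hi)

theorem setIntegral_element_sub_const_sq {f : ℝ → ℝ} {i : ℕ} (hi : i < T.n)
    (hf : MemLp f 2 (volume.restrict (T.element i))) (a : ℝ) :
    ∫ t in T.element i, (f t - a) ^ 2 = (∫ t in T.element i, f t ^ 2)
      - 2 * a * (∫ t in T.element i, f t) + a ^ 2 * (T.node (i + 1) - T.node i) := by
  have : IsFiniteMeasure (volume.restrict (T.element i)) := by unfold element; infer_instance
  have h1 : ∀ t, (f t - a) ^ 2 = f t ^ 2 - 2 * a * f t + a ^ 2 := fun t => by ring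
  have h2 : Integrable f (volume.restrict (T.element i)) := hf.integrable (by norm_num)
  have h3 : Integrable (fun t => f t ^ 2 - 2 * a * f t) (volume.restrict (T.element i)) :=
    hf.integrable_sq.sub (h2.const_mul _)
  simp only [h1]
  rw [integral_add h3 (integrable_const _), integral_sub hf.integrable_sq (h2.const_mul _),
    integral_const_mul]
  simp only [element, integral_const, MeasurableSet.univ, measureReal_restrict_apply, univ_inter,
    Real.volume_real_Ioc_of_le (T.node_lt i hi).le, smul_eq_mul]
  ring

/-- Expanding squares, the two sides differ by `(mean - a)²` times the width. The constant `a` stays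
free: `a = 0` gives stability, a nodal value gives first-order approximation. -/
theorem setIntegral_sub_mean_sq_le {f : ℝ → ℝ} {i : ℕ} (hi : i < T.n)
    (hf : MemLp f 2 (volume.restrict (T.element i))) (a : ℝ) :
    ∫ t in T.element i, (f t - T.meanProj f t) ^ 2 ≤ ∫ t in T.element i, (f t - a) ^ 2 := by
  have hw := T.width_pos hi
  have e : ∫ t in T.element i, (f t - T.meanProj f t) ^ 2
      = ∫ t in T.element i, (f t - T.elementMean f i) ^ 2 :=
    setIntegral_congr_fun measurableSet_Ioc fun t ht => by simp only [T.meanProj_eq f hi ht]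
  rw [e, T.setIntegral_element_sub_const_sq hi hf, T.setIntegral_element_sub_const_sq hi hf]
  have hm : ∫ t in T.element i, f t = T.elementMean f i * (T.node (i + 1) - T.node i) := by
    rw [elementMean, div_mul_cancel₀ _ hw.ne']
  rw [hm]
  nlinarith [mul_nonneg (sq_nonneg (T.elementMean f i - a)) hw.le]

theorem memLp_sub_meanProj {f : ℝ → ℝ} (hf : MemLp f 2 (volume.restrict (Ioc 0 Θ))) :
    MemLp (fun t => f t - T.meanProj f t) 2 (volume.restrict (Ioc 0 Θ)) :=
  hf.sub (T.memLp_meanProj f)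

theorem integral_sub_meanProj_sq_le {f : ℝ → ℝ} (hf : MemLp f 2 (volume.restrict (Ioc 0 Θ))) :
    ∫ t in Ioc 0 Θ, (f t - T.meanProj f t) ^ 2 ≤ 1 * ∫ t in Ioc 0 Θ, f t ^ 2 := by
  refine T.setIntegral_le_of_element (T.memLp_sub_meanProj hf).integrable_sq hf.integrable_sq
    fun i hi => ?_
  rw [one_mul]
  simpa using T.setIntegral_sub_mean_sq_le hi (T.memLp_element hf hi) 0

/-- A Poincaré inequality for functions vanishing at the left node: Cauchy–Schwarz bounds `z²` by
the width times `∫ g²`, and integration over the element gives a second width. -/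
theorem setIntegral_primitive_sq_le {g z : ℝ → ℝ} {i : ℕ} (hi : i < T.n)
    (hg : MemLp g 2 (volume.restrict (Ioc 0 Θ)))
    (hzm : AEStronglyMeasurable z (volume.restrict (T.element i)))
    (hz : ∀ᵐ θ ∂volume.restrict (T.element i), z θ = ∫ t in (T.node i)..θ, g t) :
    ∫ θ in T.element i, z θ ^ 2 ≤ T.meshSize ^ 2 * ∫ θ in T.element i, g θ ^ 2 := by
  have hw := T.width_pos hi
  have hwm := T.width_le_meshSize hi
  have hnn : 0 ≤ ∫ θ in T.element i, g θ ^ 2 := integral_nonneg fun _ => sq_nonneg _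
  have h1 := (memLp_of_sq_le_const (K := (T.node (i + 1) - T.node i) * ∫ t in T.element i, g t ^ 2)
    (T.node_lt i hi).le hzm (by
      rw [← element]
      filter_upwards [hz, ae_restrict_mem measurableSet_Ioc] with θ hθ hθm
      rw [hθ]
      exact sq_intervalIntegral_le (T.memLp_element hg hi) ⟨le_rfl, (T.node_lt i hi).le⟩
        ⟨hθm.1.le, hθm.2⟩)).2
  refine h1.trans ?_
  rw [← mul_assoc]
  refine mul_le_mul_of_nonneg_right ?_ hnn
  nlinarith

theorem integral_sub_meanProj_sq_le_of_primitive (hΘ : 0 < Θ) {f g : ℝ → ℝ} {k : ℝ}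
    (hf : MemLp f 2 (volume.restrict (Ioc 0 Θ)))
    (hg : MemLp g 2 (volume.restrict (Ioc 0 Θ)))
    (h : ∀ᵐ θ ∂volume.restrict (Ioc 0 Θ), f θ = k + ∫ t in (0 : ℝ)..θ, g t) :
    ∫ t in Ioc 0 Θ, (f t - T.meanProj f t) ^ 2 ≤ T.meshSize ^ 2 * ∫ t in Ioc 0 Θ, g t ^ 2 := by
  refine T.setIntegral_le_of_element (T.memLp_sub_meanProj hf).integrable_sq hg.integrable_sq
    fun i hi => ?_
  have hfi := T.memLp_element hf hi
  -- The comparison constant is the value of the primitive at the left node, so that the difference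
  -- is a primitive vanishing there.
  refine (T.setIntegral_sub_mean_sq_le hi hfi (k + ∫ t in (0 : ℝ)..T.node i, g t)).trans ?_
  refine T.setIntegral_primitive_sq_le hi hg (hfi.1.sub aestronglyMeasurable_const) ?_
  filter_upwards [ae_restrict_of_ae_restrict_of_subset (T.element_subset hi) h,
    ae_restrict_mem measurableSet_Ioc] with θ hθ hθm
  have h0 : (0 : ℝ) ∈ Icc 0 Θ := ⟨le_rfl, hΘ.le⟩
  have hθm' := T.element_subset hi hθm
  have h1 := intervalIntegral.integral_add_adjacent_intervals
    (intervalIntegrable_of_memLp hg hΘ.le h0 (T.node_mem hi.le))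
    (intervalIntegrable_of_memLp hg hΘ.le (T.node_mem hi.le) ⟨hθm'.1.le, hθm'.2⟩)
  rw [hθ, ← h1]
  ring

/-- Subtracting the mean leaves integral zero on each element. Hence the primitive of the deviation
vanishes at all nodes, which is what localises the next estimates. -/
theorem integral_node_sub_meanProj (hΘ : 0 < Θ) {f : ℝ → ℝ}
    (hf : MemLp f 2 (volume.restrict (Ioc 0 Θ))) :
    ∀ i ≤ T.n, ∫ t in (0 : ℝ)..T.node i, (f t - T.meanProj f t) = 0 := by
  have hi' := T.memLp_sub_meanProj hf
  intro i
  induction i with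
  | zero => intro _; rw [T.node_zero, intervalIntegral.integral_same]
  | succ i ih =>
    intro hi
    have hlt : i < T.n := hi
    have : IsFiniteMeasure (volume.restrict (T.element i)) := by unfold element; infer_instance
    rw [← intervalIntegral.integral_add_adjacent_intervals
      (intervalIntegrable_of_memLp hi' hΘ.le ⟨le_rfl, hΘ.le⟩ (T.node_mem hlt.le))
      (intervalIntegrable_of_memLp hi' hΘ.le (T.node_mem hlt.le) (T.node_mem hi)),
      ih hlt.le, zero_add, intervalIntegral.integral_of_le (T.node_lt i hlt).le, ← element]
    have e : ∫ t in T.element i, (f t - T.meanProj f t)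
        = ∫ t in T.element i, (f t - T.elementMean f i) :=
      setIntegral_congr_fun measurableSet_Ioc fun t ht => by simp only [T.meanProj_eq f hlt ht]
    rw [e, integral_sub ((T.memLp_element hf hlt).integrable (by norm_num)) (integrable_const _)]
    simp only [element, integral_const, MeasurableSet.univ, measureReal_restrict_apply, univ_inter,
      Real.volume_real_Ioc_of_le (T.node_lt i hlt).le, smul_eq_mul]
    rw [elementMean, mul_div_cancel₀ _ (T.width_pos hlt).ne', element, sub_self]

/-- The interpolation error is the primitive of the deviation of the derivative from its means. -/
theorem sub_sum_mul_hat_eq (hΘ : 0 < Θ) {f : ℝ → ℝ} {k : ℝ} {p : ℕ → ℝ}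
    (hf : MemLp f 2 (volume.restrict (Ioc 0 Θ)))
    (hp : ∀ i ≤ T.n, p i = k + ∫ t in (0 : ℝ)..T.node i, f t) {θ : ℝ} (hθ : θ ∈ Ioc 0 Θ) :
    (k + ∫ t in (0 : ℝ)..θ, f t) - ∑ i ∈ Finset.range (T.n + 1), p i * T.hat i θ
      = ∫ t in (0 : ℝ)..θ, (f t - T.meanProj f t) := by
  obtain ⟨j, hj, hθj⟩ := T.exists_mem_element hθ
  have h0 : (0 : ℝ) ∈ Icc 0 Θ := ⟨le_rfl, hΘ.le⟩
  have hθ' : θ ∈ Icc 0 Θ := ⟨hθ.1.le, hθ.2⟩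
  have hjn := T.node_mem hj.le
  have hjn' := T.node_mem (Nat.succ_le_of_lt hj)
  have hfm := T.memLp_sub_meanProj hf
  have e1 := intervalIntegral.integral_add_adjacent_intervals
    (intervalIntegrable_of_memLp hf hΘ.le h0 hjn) (intervalIntegrable_of_memLp hf hΘ.le hjn hθ')
  have e2 := intervalIntegral.integral_add_adjacent_intervals
    (intervalIntegrable_of_memLp hf hΘ.le h0 hjn) (intervalIntegrable_of_memLp hf hΘ.le hjn hjn')
  have e3 := intervalIntegral.integral_add_adjacent_intervals
    (intervalIntegrable_of_memLp hfm hΘ.le h0 hjn) (intervalIntegrable_of_memLp hfm hΘ.le hjn hθ')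
  have e4 : ∫ t in (T.node j)..θ, (f t - T.meanProj f t)
      = (∫ t in (T.node j)..θ, f t) - T.elementMean f j * (θ - T.node j) := by
    have e5 : ∫ t in (T.node j)..θ, (f t - T.meanProj f t)
        = ∫ t in (T.node j)..θ, (f t - T.elementMean f j) := by
      rw [intervalIntegral.integral_of_le hθj.1.le, intervalIntegral.integral_of_le hθj.1.le]
      exact setIntegral_congr_fun measurableSet_Ioc fun t ht => by
        simp only [T.meanProj_eq f hj (⟨ht.1, ht.2.trans hθj.2⟩ : t ∈ T.element j)]
    rw [e5, intervalIntegral.integral_sub (intervalIntegrable_of_memLp hf hΘ.le hjn hθ')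
      intervalIntegrable_const, intervalIntegral.integral_const, smul_eq_mul, mul_comm]
  have e6 : T.elementMean f j
      = (∫ t in (T.node j)..T.node (j + 1), f t) / (T.node (j + 1) - T.node j) := by
    rw [elementMean, intervalIntegral.integral_of_le (T.node_lt j hj).le, element]
  -- On the element both sides reduce to `∫_{θ_j}^θ f` minus a slope times `θ - θ_j`: the slope of
  -- the interpolant is the difference quotient of nodal values, that is, the mean of `f`.
  rw [T.sum_mul_hat hj hθj, hp j hj.le, hp (j + 1) hj, ← e3,
    T.integral_node_sub_meanProj hΘ hf j hj.le, e4, e6, ← e1, ← e2]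
  ring

/-- Because the primitive vanishes at every node, it can be restarted at the left end of each
element, and the constant is the mesh size instead of `Θ`. -/
theorem integral_primitive_sub_meanProj_sq_le (hΘ : 0 < Θ) {f z : ℝ → ℝ}
    (hf : MemLp f 2 (volume.restrict (Ioc 0 Θ)))
    (hzm : AEStronglyMeasurable z (volume.restrict (Ioc 0 Θ)))
    (hz : ∀ᵐ θ ∂volume.restrict (Ioc 0 Θ), z θ = ∫ t in (0 : ℝ)..θ, (f t - T.meanProj f t)) :
    MemLp z 2 (volume.restrict (Ioc 0 Θ)) ∧ ∫ θ in Ioc 0 Θ, z θ ^ 2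
      ≤ T.meshSize ^ 2 * ∫ θ in Ioc 0 Θ, (f θ - T.meanProj f θ) ^ 2 := by
  have hfm := T.memLp_sub_meanProj hf
  have h0 : (0 : ℝ) ∈ Icc 0 Θ := ⟨le_rfl, hΘ.le⟩
  have hzL : MemLp z 2 (volume.restrict (Ioc 0 Θ)) := by
    refine (memLp_of_sq_le_const
      (K := (Θ - 0) * ∫ t in Ioc 0 Θ, (f t - T.meanProj f t) ^ 2) hΘ.le hzm ?_).1
    filter_upwards [hz, ae_restrict_mem measurableSet_Ioc] with θ hθ hθm
    rw [hθ]
    exact sq_intervalIntegral_le hfm h0 ⟨hθm.1.le, hθm.2⟩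
  refine ⟨hzL, T.setIntegral_le_of_element hzL.integrable_sq hfm.integrable_sq fun i hi => ?_⟩
  refine T.setIntegral_primitive_sq_le hi hfm (hzm.mono_measure
    (Measure.restrict_mono_set _ (T.element_subset hi))) ?_
  filter_upwards [ae_restrict_of_ae_restrict_of_subset (T.element_subset hi) hz,
    ae_restrict_mem measurableSet_Ioc] with θ hθ hθm
  have hθm' := T.element_subset hi hθm
  rw [hθ, ← intervalIntegral.integral_add_adjacent_intervals
    (intervalIntegrable_of_memLp hfm hΘ.le h0 (T.node_mem hi.le))
    (intervalIntegrable_of_memLp hfm hΘ.le (T.node_mem hi.le) ⟨hθm'.1.le, hθm'.2⟩),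
    T.integral_node_sub_meanProj hΘ hf i hi.le, zero_add]

end AngularPartition

/-! ### Interpolation on the rectangle -/

theorem memL2_wr_mul {Θ : ℝ} {g η : ℝ → ℝ} (hg : MemL2 (Ioo 0 1) (fun r => r) g)
    (hη : Continuous η) : MemL2 (Q Θ) wr fun p => g p.1 * η p.2 := by
  have h1 : IntegrableOn (fun t => η t ^ 2) (Ioo 0 Θ) :=
    ((hη.pow 2).continuousOn.integrableOn_compact isCompact_Icc).mono_set Ioo_subset_Icc_self
  constructor
  · rw [volume_restrict_Q]
    exact hg.1.comp_fst.mul hη.aestronglyMeasurable.comp_snd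
  · rw [IntegrableOn, volume_restrict_Q]
    refine (Integrable.mul_prod hg.2 h1).congr (ae_of_all _ fun p => ?_)
    simp only [wr]
    ring

/-- For fixed `θ` the slice `φ(·, θ)` is a test function on `(0,1)`, so Fubini is used with the
radial integral inside. The factor `η` is never differentiated; continuity suffices, as for hat
functions. -/
theorem isWeakDeriv_mul {Θ : ℝ} {g g' η : ℝ → ℝ} (hg : MemL2 (Ioo 0 1) (fun r => r) g)
    (hg' : MemL2 (Ioo 0 1) (fun r => r) g') (hd : IsWeakDeriv (Ioo 0 1) (1 : ℝ) g g')
    (hη : Continuous η) :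
    IsWeakDeriv (Q Θ) dirR (fun p => g p.1 * η p.2) fun p => g' p.1 * η p.2 := by
  have l1 := (memL2_wr_mul (Θ := Θ) hg hη).wr_locallyIntegrableOn
  have l2 := (memL2_wr_mul (Θ := Θ) hg' hη).wr_locallyIntegrableOn
  refine ⟨l1, l2, fun φ hφ hc hs => ?_⟩
  have hi1 : IntegrableOn (fun p => g p.1 * η p.2 * fderiv ℝ φ p dirR) (Q Θ) :=
    (integrable_mul_of_tsupport_subset l1 (continuous_fderiv_apply_const hφ _)
      (hc.fderiv_apply ℝ _) ((tsupport_fderiv_apply_subset ℝ _).trans hs)).integrableOn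
  have hi2 : IntegrableOn (fun p => g' p.1 * η p.2 * φ p) (Q Θ) :=
    (integrable_mul_of_tsupport_subset l2 hφ.continuous hc hs).integrableOn
  rw [IntegrableOn, volume_restrict_Q] at hi1 hi2
  rw [volume_restrict_Q, integral_prod_symm _ hi1, integral_prod_symm _ hi2, ← integral_neg]
  refine integral_congr_ae (ae_of_all _ fun θ => ?_)
  have hK : IsCompact (Prod.fst '' tsupport φ) := hc.isCompact.image continuous_fst
  have h0 : ∀ r, r ∉ Prod.fst '' tsupport φ → φ (r, θ) = 0 := fun r hr =>
    image_eq_zero_of_notMem_tsupport fun h => hr ⟨_, h, rfl⟩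
  have h1 := hd.2.2 (fun r => φ (r, θ)) (hφ.comp (contDiff_id.prodMk contDiff_const))
    (HasCompactSupport.intro hK h0)
    ((closure_minimal (fun r (hr : φ (r, θ) ≠ 0) => by_contra fun h => hr (h0 r h))
      hK.isClosed).trans (by
      rintro _ ⟨p, hp, rfl⟩
      exact (hs hp).1))
  simp only [fderiv_apply_one_eq_deriv, (fderiv_apply_dirR hφ _ θ).deriv] at h1
  have e1 : ∀ r, g r * η θ * fderiv ℝ φ (r, θ) dirR = η θ * (g r * fderiv ℝ φ (r, θ) dirR) :=
    fun r => by ring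
  have e2 : ∀ r, g' r * η θ * φ (r, θ) = η θ * (g' r * φ (r, θ)) := fun r => by ring
  simp only [e1, e2, integral_const_mul, h1, mul_neg]

/-- The deviation of `g` from its angular element means. -/
noncomputable def meanDeviation {Θ : ℝ} (T : AngularPartition Θ) (g : ℝ × ℝ → ℝ) (p : ℝ × ℝ) : ℝ :=
  g p - T.meanProj (fun t => g (p.1, t)) p.2

section Interpolation

variable {Θ : ℝ} (T : AngularPartition Θ)

theorem stronglyMeasurable_meanDeviation {g : ℝ × ℝ → ℝ} (hg : StronglyMeasurable g) :
    StronglyMeasurable (meanDeviation T g) := by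
  refine hg.sub (Finset.stronglyMeasurable_fun_sum _ fun i _ => ?_)
  have h1 : StronglyMeasurable fun p : ℝ × ℝ => T.elementMean (fun t => g (p.1, t)) i :=
    ((stronglyMeasurable_integral_Ioc hg measurable_const measurable_const
      measurable_fst).measurable.div_const _).stronglyMeasurable
  exact h1.indicator (measurable_snd measurableSet_Ioc)

theorem memL2_meanDeviation {g : ℝ × ℝ → ℝ} (hg : StronglyMeasurable g)
    (hg2 : MemL2 (Q Θ) wr g) : MemL2 (Q Θ) wr (meanDeviation T g) ∧
      ∫ p in Q Θ, meanDeviation T g p ^ 2 * wr p ≤ 1 * ∫ p in Q Θ, g p ^ 2 * wr p := by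
  refine MemL2.of_slices (ρ := fun r => r) measurable_id radial_nonneg
    (stronglyMeasurable_meanDeviation T hg).aestronglyMeasurable hg2 ?_
  filter_upwards [hg2.ae_memLp_slice] with r hr
  exact ⟨T.memLp_sub_meanProj hr, T.integral_sub_meanProj_sq_le hr⟩

/-- Here `b` is only assumed in `L²_r`. The deviation lies in `L²_{1/r}` because on each slice it is
controlled by `e`, which does. -/
theorem memL2_meanDeviation_of_primitive (hΘ : 0 < Θ) {b e : ℝ × ℝ → ℝ} {c : ℝ → ℝ}
    (hb : StronglyMeasurable b) (hb2 : MemL2 (Q Θ) wr b) (he2 : MemL2 (Q Θ) wrInv e)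
    (h : ∀ᵐ p ∂volume.restrict (Q Θ), b p = c p.1 + angularPrimitive e p) :
    MemL2 (Q Θ) wrInv (meanDeviation T b) ∧ ∫ p in Q Θ, meanDeviation T b p ^ 2 * wrInv p
      ≤ T.meshSize ^ 2 * ∫ p in Q Θ, e p ^ 2 * wrInv p := by
  refine MemL2.of_slices (ρ := fun r => 1 / r) (measurable_const.div measurable_id)
    (fun r hr => one_div_nonneg.2 hr.1.le)
    (stronglyMeasurable_meanDeviation T hb).aestronglyMeasurable he2 ?_
  filter_upwards [hb2.ae_memLp_slice, he2.wr_of_wrInv.ae_memLp_slice, ae_Q_iff_slices h]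
    with r hbr her hr
  exact ⟨T.memLp_sub_meanProj hbr,
    T.integral_sub_meanProj_sq_le_of_primitive hΘ hbr her hr⟩

theorem memL2_primitive_meanDeviation (hΘ : 0 < Θ) {v g : ℝ × ℝ → ℝ}
    (hv : AEStronglyMeasurable v (volume.restrict (Q Θ)))
    (hg : StronglyMeasurable g) (hg2 : MemL2 (Q Θ) wr g)
    (h : ∀ᵐ r ∂volume.restrict (Ioo (0 : ℝ) 1), ∀ᵐ θ ∂volume.restrict (Ioc 0 Θ),
      v (r, θ) = angularPrimitive (meanDeviation T g) (r, θ)) :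
    MemL2 (Q Θ) wr v ∧ ∫ p in Q Θ, v p ^ 2 * wr p
      ≤ T.meshSize ^ 2 * ∫ p in Q Θ, meanDeviation T g p ^ 2 * wr p := by
  have hm : ∀ᵐ r ∂volume.restrict (Ioo (0 : ℝ) 1),
      AEStronglyMeasurable (fun θ => v (r, θ)) (volume.restrict (Ioc 0 Θ)) := by
    rw [volume_restrict_Q] at hv
    rw [restrict_Ioc_eq]
    exact hv.prodMk_left
  refine MemL2.of_slices (ρ := fun r => r) measurable_id radial_nonneg hv
    (memL2_meanDeviation T hg hg2).1 ?_
  filter_upwards [hg2.ae_memLp_slice, h, hm] with r hgr hr hmr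
  exact T.integral_primitive_sub_meanProj_sq_le hΘ hgr hmr hr

/-- The nodal family `p` is general so that the identity serves both for `u` with its traces and for
`∂_r u` with the derivatives of the traces. -/
theorem sub_sum_eq_primitive (hΘ : 0 < Θ) {v g : ℝ × ℝ → ℝ} {k : ℝ → ℝ} {p : ℕ → ℝ → ℝ}
    (hg2 : MemL2 (Q Θ) wr g)
    (h : ∀ᵐ q ∂volume.restrict (Q Θ), v q = k q.1 + angularPrimitive g q)
    (hp : ∀ i ≤ T.n, p i =ᵐ[volume.restrict (Ioo 0 1)]
      fun r => k r + angularPrimitive g (r, T.node i)) :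
    ∀ᵐ r ∂volume.restrict (Ioo (0 : ℝ) 1), ∀ᵐ θ ∂volume.restrict (Ioc 0 Θ),
      v (r, θ) - ∑ i ∈ Finset.range (T.n + 1), p i r * T.hat i θ
        = angularPrimitive (meanDeviation T g) (r, θ) := by
  have hp' : ∀ᵐ r ∂volume.restrict (Ioo (0 : ℝ) 1), ∀ i, i ≤ T.n →
      p i r = k r + angularPrimitive g (r, T.node i) := by
    refine ae_all_iff.2 fun i => ?_
    by_cases hi : i ≤ T.n
    · exact (hp i hi).mono fun r hr _ => hr
    · exact ae_of_all _ fun r h' => absurd h' hi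
  filter_upwards [hp', ae_Q_iff_slices h, hg2.ae_memLp_slice] with r hpr hr hgr
  filter_upwards [hr, ae_restrict_mem measurableSet_Ioc] with θ hθ hθm
  rw [hθ]
  exact T.sub_sum_mul_hat_eq hΘ (p := fun i => p i r) hgr hpr hθm

/-- The components of the interpolation error. -/
theorem MemU'.interpolation_error (hΘ : 0 < Θ) {u : ℝ × ℝ → ℝ} (hu : MemU' Θ u) :
    MemH1 Θ (interpolant T u) ∧
    normL2 (Q Θ) wr (u - interpolant T u) ^ 2
      ≤ T.meshSize ^ 4 * normL2 (Q Θ) wrInv (dThetaTheta Θ u) ^ 2 ∧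
    normL2 (Q Θ) wr (dR Θ (u - interpolant T u)) ^ 2
      ≤ T.meshSize ^ 2 * normL2 (Q Θ) wr (dRTheta Θ u) ^ 2 ∧
    normL2 (Q Θ) wrInv (dTheta Θ (u - interpolant T u)) ^ 2
      ≤ T.meshSize ^ 2 * normL2 (Q Θ) wrInv (dThetaTheta Θ u) ^ 2 := by
  obtain ⟨hU, heW, he⟩ := hu
  have hΩ := isOpen_Q Θ
  have hΩm := measurableSet_Q Θ
  obtain ⟨b, d, k, k', hX⟩ := hU.exists_angularExpansion hΘ
  have hb2 := hX.b_mem.wr_of_wrInv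
  obtain ⟨e, c, -, -, hee, hbe⟩ := exists_eq_primitive_of_isWeakDeriv hΘ hb2
    he.wr_of_wrInv ((IsWeakDeriv.isWeakDeriv_weakDeriv heW).congr hX.b_ae (EventuallyEq.refl _ _))
  have he2 := he.congr hee
  let γ : ℕ → ℝ → ℝ := fun i r => k r + angularPrimitive b (r, T.node i)
  let γ' : ℕ → ℝ → ℝ := fun i r => k' r + angularPrimitive d (r, T.node i)
  have hγm := fun i (hi : i ≤ T.n) => hX.memL2_trace hΘ (T.node_mem hi) hU
  have htr := fun i (hi : i ≤ T.n) => hX.radialTrace_ae_eq hΘ (T.node_mem hi) hU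
  have htrm : ∀ i, i ≤ T.n → MemL2 (Ioo 0 1) (fun r => r) (radialTrace Θ (T.node i) u) :=
    fun i hi => (hγm i hi).1.congr (htr i hi).symm
  have hmem : ∀ i ∈ Finset.range (T.n + 1), i ≤ T.n := fun i hi =>
    Nat.lt_succ_iff.1 (Finset.mem_range.1 hi)
  -- the error
  have hIm : AEStronglyMeasurable (interpolant T u) (volume.restrict (Q Θ)) :=
    Finset.aestronglyMeasurable_fun_sum _ fun i hi =>
      (memL2_wr_mul (htrm i (hmem i hi)) (T.continuous_hat i)).1
  have hz := sub_sum_eq_primitive T hΘ (p := fun i => radialTrace Θ (T.node i) u) hb2 hX.u_eq htr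
  obtain ⟨z2, zle⟩ := memL2_primitive_meanDeviation T hΘ (v := u - interpolant T u)
    (hU.1.1.1.sub hIm) hX.b_meas hb2 hz
  -- its angular derivative
  obtain ⟨t2, tle⟩ := memL2_meanDeviation_of_primitive T hΘ hX.b_meas hb2 he2 hbe
  have hzθ : IsWeakDeriv (Q Θ) dirTheta (u - interpolant T u) (meanDeviation T b) :=
    isWeakDeriv_of_ae_primitive (c := 0) hΘ z2 t2.wr_of_wrInv
      (by simpa only [Pi.zero_apply, zero_add, Pi.sub_apply, interpolant] using hz)
  -- its radial derivative
  let I' : ℝ × ℝ → ℝ := fun p => ∑ i ∈ Finset.range (T.n + 1), γ' i p.1 * T.hat i p.2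
  have hIr : IsWeakDeriv (Q Θ) dirR (interpolant T u) I' := by
    convert IsWeakDeriv.sum (Finset.range (T.n + 1)) (fun i hi =>
      isWeakDeriv_mul (Θ := Θ) (htrm i (hmem i hi)) (hγm i (hmem i hi)).2
        ((hX.isWeakDeriv_trace hΘ (T.node_mem (hmem i hi)) hU).congr (htr i (hmem i hi)).symm
          (EventuallyEq.refl _ _)) (T.continuous_hat i)) using 1
    · funext p; simp only [interpolant, Finset.sum_apply]
    · funext p; simp only [I', γ', Finset.sum_apply]
  have hI'm : AEStronglyMeasurable I' (volume.restrict (Q Θ)) :=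
    Finset.aestronglyMeasurable_fun_sum _ fun i hi =>
      (memL2_wr_mul (hγm i (hmem i hi)).2 (T.continuous_hat i)).1
  have hzR := sub_sum_eq_primitive T hΘ (p := γ') hX.d_mem hX.dR_eq
    (fun i _ => EventuallyEq.refl _ _)
  -- `I'` is the interpolant of `∂_r u`, so the radial derivative of the error is itself an
  -- interpolation error, with `d` in the role of `b`.
  obtain ⟨r2, rle⟩ := memL2_primitive_meanDeviation T hΘ (v := dR Θ u - I')
    (hU.1.2.1.2.1.sub hI'm) hX.d_meas hX.d_mem hzR
  have hur := IsWeakDeriv.isWeakDeriv_weakDeriv hU.1.2.1.1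
  have huθ := IsWeakDeriv.isWeakDeriv_weakDeriv hU.1.2.2.1
  have hzr : IsWeakDeriv (Q Θ) dirR (u - interpolant T u) (dR Θ u - I') := hur.sub hIr
  -- Writing the interpolant as `u` minus the error yields its angular derivative and its
  -- integrability without differentiating the hat functions.
  have hIθ : IsWeakDeriv (Q Θ) dirTheta (interpolant T u) (dTheta Θ u - meanDeviation T b) := by
    have := huθ.sub hzθ
    rwa [sub_sub_cancel] at this
  have h4 := T.meshSize_nonneg
  refine ⟨⟨?_, ⟨⟨_, hIr⟩, ?_⟩, ⟨_, hIθ⟩, ?_⟩, ?_, ?_, ?_⟩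
  · have := hU.1.1.sub hΩm aestronglyMeasurable_wr wr_nonneg z2
    rwa [sub_sub_cancel] at this
  · have := hU.1.2.1.2.sub hΩm aestronglyMeasurable_wr wr_nonneg r2
    rw [sub_sub_cancel] at this
    exact this.congr (hIr.weakDeriv_ae_eq hΩ).symm
  · exact (hU.1.2.2.2.sub hΩm aestronglyMeasurable_wrInv wrInv_nonneg t2).congr
      (hIθ.weakDeriv_ae_eq hΩ).symm
  · rw [normL2_wr_sq, normL2_congr hee, normL2_wrInv_sq]
    refine zle.trans ?_
    -- The deviation is moved from weight `r` to weight `1/r` before the second factor `h²` is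
    -- gained from `∂_{θθ} u`.
    have h5 := (normL2_wr_le_normL2_wrInv t2).trans tle
    calc _ ≤ T.meshSize ^ 2 * (T.meshSize ^ 2 * ∫ p in Q Θ, e p ^ 2 * wrInv p) :=
          mul_le_mul_of_nonneg_left h5 (sq_nonneg _)
      _ = _ := by ring
  · have h5 : dR Θ (u - interpolant T u) =ᵐ[volume.restrict (Q Θ)] _ := hzr.weakDeriv_ae_eq hΩ
    rw [normL2_congr h5, normL2_congr hX.d_ae, normL2_wr_sq, normL2_wr_sq]
    have h6 := (memL2_meanDeviation T hX.d_meas hX.d_mem).2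
    rw [one_mul] at h6
    exact rle.trans (mul_le_mul_of_nonneg_left h6 (sq_nonneg _))
  · have h5 : dTheta Θ (u - interpolant T u) =ᵐ[volume.restrict (Q Θ)] _ :=
      hzθ.weakDeriv_ae_eq hΩ
    rw [normL2_congr h5, normL2_congr hee, normL2_wrInv_sq, normL2_wrInv_sq]
    exact tle

end Interpolation

end SBFEM

/-! ### Assembly of the error bounds -/

theorem mainTheorem1 (Θ : ℝ) (hΘ : 0 < Θ) (hΘ' : Θ < 2 * Real.pi) :
    ∃ C : ℝ, 0 < C ∧
      ∀ u : ℝ × ℝ → ℝ, SBFEM.MemU' Θ u →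
      ∀ T : SBFEM.AngularPartition Θ,
        (∀ i ≤ T.n, SBFEM.IsRadialTrace Θ (T.node i) u (SBFEM.radialTrace Θ (T.node i) u)) ∧
        SBFEM.MemH1 Θ (SBFEM.interpolant T u) ∧
        SBFEM.normL2 (SBFEM.Q Θ) SBFEM.wr (u - SBFEM.interpolant T u)
          ≤ T.meshSize ^ 2 * SBFEM.normL2 (SBFEM.Q Θ) SBFEM.wrInv (SBFEM.dThetaTheta Θ u) ∧
        SBFEM.normH1 Θ (u - SBFEM.interpolant T u)
          ≤ C * T.meshSize *
            Real.sqrt (SBFEM.normL2 (SBFEM.Q Θ) SBFEM.wr (SBFEM.dRTheta Θ u) ^ 2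
              + SBFEM.normL2 (SBFEM.Q Θ) SBFEM.wrInv (SBFEM.dThetaTheta Θ u) ^ 2) ∧
        SBFEM.normH1 Θ (u - SBFEM.interpolant T u) ^ 2
          ≤ T.meshSize ^ 2 * (T.meshSize ^ 2 + 4) *
            (SBFEM.normL2 (SBFEM.Q Θ) SBFEM.wr (SBFEM.dRTheta Θ u) ^ 2
              + SBFEM.normL2 (SBFEM.Q Θ) SBFEM.wrInv (SBFEM.dThetaTheta Θ u) ^ 2) := by
  -- Since `h ≤ Θ`, the factor `h² + 4` of the squared estimate is at most `Θ² + 4`.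
  refine ⟨√(Θ ^ 2 + 4), by positivity, fun u hu T => ?_⟩
  obtain ⟨b, d, k, k', hX⟩ := hu.1.exists_angularExpansion hΘ
  obtain ⟨h1, h2, h3, h4⟩ := hu.interpolation_error T hΘ
  have hm := T.meshSize_nonneg
  have hmΘ := T.meshSize_le hΘ
  have hsq : SBFEM.normH1 Θ (u - SBFEM.interpolant T u) ^ 2
      ≤ T.meshSize ^ 2 * (T.meshSize ^ 2 + 4) *
        (SBFEM.normL2 (SBFEM.Q Θ) SBFEM.wr (SBFEM.dRTheta Θ u) ^ 2
          + SBFEM.normL2 (SBFEM.Q Θ) SBFEM.wrInv (SBFEM.dThetaTheta Θ u) ^ 2) := by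
    rw [SBFEM.normH1_sq]
    set D := SBFEM.normL2 (SBFEM.Q Θ) SBFEM.wr (SBFEM.dRTheta Θ u) ^ 2 with hD
    set E := SBFEM.normL2 (SBFEM.Q Θ) SBFEM.wrInv (SBFEM.dThetaTheta Θ u) ^ 2 with hE
    have hD0 : 0 ≤ D := sq_nonneg _
    have hE0 : 0 ≤ E := sq_nonneg _
    -- The components sum to at most `h⁴ E + h² D + h² E`; this nonnegative quantity is exactly what
    -- separates that sum from `h² (h² + 4)(D + E)`.
    have h5 : 0 ≤ T.meshSize ^ 2 * (T.meshSize ^ 2 * D + 3 * (D + E)) := by positivity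
    nlinarith
  refine ⟨fun i hi => hX.isRadialTrace_radialTrace hΘ (T.node_mem hi) hu.1, h1, ?_, ?_, hsq⟩
  · have n1 : 0 ≤ SBFEM.normL2 (SBFEM.Q Θ) SBFEM.wr (u - SBFEM.interpolant T u) :=
      Real.sqrt_nonneg _
    have n2 : 0 ≤ SBFEM.normL2 (SBFEM.Q Θ) SBFEM.wrInv (SBFEM.dThetaTheta Θ u) :=
      Real.sqrt_nonneg _
    refine (sq_le_sq₀ n1 (mul_nonneg (sq_nonneg _) n2)).1 (h2.trans (le_of_eq ?_))
    ring
  · refine (sq_le_sq₀ (Real.sqrt_nonneg _) (by positivity)).1 (hsq.trans ?_)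
    rw [mul_pow, mul_pow, Real.sq_sqrt (by positivity), Real.sq_sqrt (by positivity),
      mul_comm (Θ ^ 2 + 4)]
    gcongr
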